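/- Let $V$ be a complex vector space of finite dimension $n$ with a Hermitian inner product $h$, let $\omega=-\operatorname{Im} h$ be its fundamental form ($h$ is linear in the first argument; $\omega=\frac i2\sum_j dz_j\wedge d\bar z_j$ in coordinates of a unitary basis), and let $\langle\cdot,\cdot\rangle$ be the induced Hermitian inner product on the exterior algebra $\bigwedge^* V^*$ of complex-valued forms, linear in the first and conjugate-linear in the second argument (for which the exterior products of distinct elements of the orthonormal coframe $dx_j, dy_j$ are orthonormal). Let $L u=\omega\wedge u$ be the Lefschetz operator, $\Lambda$ its adjoint, and $\mathbf I=\sum_{p,q} i^{p-q}\pi_{p,q}$, where $\pi_{p,q}$ is the orthogonal projection onto the $(p,q)$-forms. For an element $A$ of an algebra put $A^{[k]}=A^k/k!$ for $k\ge 0$ and, for $A=\omega$, $A^{[k]}=0$ for $k<0$. Let $(b_l)_{l\ge0}$ be the integers determined by $b_0=1$ and $\sum_{l=0}^{m}(-1)^l\binom{m}{l}^2 b_l=0$ for all $m\ge1$. Let $p,q\ge0$ and $k=p+q$. If $u$ and $v$ are complex $(p,q)$-forms on $V$, then $$ (-1)^{k(k+1)/2}\,\langle u,v\rangle\,\omega^{[n]}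 =\sum_{l=0}^{n}(-1)^l\, b_l\;\Lambda^{[l]}u\wedge\Lambda^{[l]}\,\overline{\mathbf I v}\wedge\omega^{[n-p-q+2l]} . $$ -/

import Mathlib

open scoped ComplexConjugate

noncomputable section

namespace HermForm

/-! ### Scalars and divided powers -/

/-- The integers `b₀ = 1`, `∑_{l=0}^{p} (-1)^l (p choose l)² b_l = 0` for `p ≥ 1`
(see `sum_b_eq_zero`). -/
def b : ℕ → ℤ
  | 0 => 1
  | p + 1 => (-1) ^ p *
      ∑ l : Fin (p + 1), (-1) ^ (l : ℕ) * ((p + 1).choose (l : ℕ) : ℤ) ^ 2 * b (l : ℕ)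

theorem b_zero : b 0 = 1 := by
  rw [b]

theorem sum_b_eq_zero (p : ℕ) (hp : 1 ≤ p) :
    ∑ l ∈ Finset.range (p + 1), (-1) ^ l * (p.choose l : ℤ) ^ 2 * b l = 0 := by
  obtain ⟨p, rfl⟩ : ∃ r, p = r + 1 := ⟨p - 1, by omega⟩
  rw [Finset.sum_range_succ, b, Finset.sum_range]
  have h : ((-1 : ℤ) ^ p) * (-1) ^ p = 1 := by
    rw [← mul_pow]; simp
  rw [Nat.choose_self, Nat.cast_one, one_pow, mul_one, pow_succ]
  linear_combination
    (-(∑ i : Fin (p + 1), (-1 : ℤ) ^ (i : ℕ) * ((p + 1).choose (i : ℕ) : ℤ) ^ 2 * b (i : ℕ))) * h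

/-- The divided power `A^[k] = A^k / k!`. -/
def dpow {A : Type*} [Ring A] [Algebra ℂ A] (x : A) (k : ℕ) : A :=
  ((k.factorial : ℂ)⁻¹) • x ^ k

/-- The divided power with an integer exponent; it is zero when the exponent is negative. -/
def zdpow {A : Type*} [Ring A] [Algebra ℂ A] (x : A) (m : ℤ) : A :=
  if 0 ≤ m then dpow x m.toNat else 0

theorem det_delta {I : Type*} [LinearOrder I] {k : ℕ} (s t : Fin k ↪o I) :
    (Matrix.of fun i j => (if s j = t i then (1 : ℂ) else 0)).det =
      if (Finset.univ.map s.toEmbedding) = (Finset.univ.map t.toEmbedding) then 1 else 0 := by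
  by_cases h : s = t
  · subst h
    have : (Matrix.of fun i j : Fin k => (if s j = s i then (1 : ℂ) else 0)) = 1 := by
      ext i j; simp [Matrix.one_apply, eq_comm]
    rw [this, Matrix.det_one, if_pos rfl]
  · have hne : Finset.univ.map s.toEmbedding ≠ Finset.univ.map t.toEmbedding := fun e => h (by
      have := congrArg (fun u : Finset I => (u : Set I)) e
      simp only [Finset.coe_map, Finset.coe_univ, Set.image_univ] at this
      exact OrderEmbedding.range_inj.1 this)
    rw [if_neg hne]
    have : ∃ i, ∀ j, s j ≠ t i := by
      by_contra! hc
      refine hne (Finset.eq_of_subset_of_card_le ?_ (by simp)).symm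
      intro x hx
      obtain ⟨i, -, rfl⟩ := Finset.mem_map.1 hx
      obtain ⟨j, hj⟩ := hc i
      exact Finset.mem_map.2 ⟨j, Finset.mem_univ _, hj⟩
    obtain ⟨i, hi⟩ := this
    exact Matrix.det_eq_zero_of_row_eq_zero i fun j => by simp [hi j]

/-! ### Complex forms on a Hermitian vector space -/

variable (V : Type*) [NormedAddCommGroup V] [InnerProductSpace ℂ V]

/-- Complex-valued real-linear functionals on `V`: the complexified dual of `V`. -/
abbrev Covector : Type _ := V →ₗ[ℝ] ℂ

/-- Complex forms on `V`: the exterior algebra of the complexified dual; its product is the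
wedge product. -/
abbrev Form : Type _ := ExteriorAlgebra ℂ (Covector V)

/-- The `(1,0)`-covectors: the complex-linear ones. -/
def covectors10 : Submodule ℂ (Covector V) where
  carrier := {a | ∀ (z : ℂ) (x : V), a (z • x) = z * a x}
  add_mem' := fun ha hb z x => by
    rw [LinearMap.add_apply, LinearMap.add_apply, ha z x, hb z x, mul_add]
  zero_mem' := fun z x => by simp
  smul_mem' := fun c a ha z x => by
    rw [LinearMap.smul_apply, LinearMap.smul_apply, ha z x, smul_eq_mul, smul_eq_mul]; ring

/-- The `(0,1)`-covectors: the conjugate-linear ones. -/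
def covectors01 : Submodule ℂ (Covector V) where
  carrier := {a | ∀ (z : ℂ) (x : V), a (z • x) = conj z * a x}
  add_mem' := fun ha hb z x => by
    rw [LinearMap.add_apply, LinearMap.add_apply, ha z x, hb z x, mul_add]
  zero_mem' := fun z x => by simp
  smul_mem' := fun c a ha z x => by
    rw [LinearMap.smul_apply, LinearMap.smul_apply, ha z x, smul_eq_mul, smul_eq_mul]; ring

/-- The space of `(p,q)`-forms: the span of the wedge products of `p` covectors of type `(1,0)`
and `q` covectors of type `(0,1)`. -/
def formsOfType (p q : ℕ) : Submodule ℂ (Form V) :=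
  (covectors10 V).map (ExteriorAlgebra.ι ℂ) ^ p * (covectors01 V).map (ExteriorAlgebra.ι ℂ) ^ q

/-! ### Complex conjugation of forms -/

variable {V} in
/-- Pointwise complex conjugation of a covector. -/
def conjCovector (a : Covector V) : Covector V :=
  Complex.conjAe.toLinearMap ∘ₗ a

variable {V} in
@[simp]
theorem conjCovector_apply (a : Covector V) (x : V) : conjCovector a x = conj (a x) := rfl

/-- A copy of the ring of forms on which the complex scalars act through their conjugates; it only
serves to construct `conjForm`. -/
def ConjForm : Type _ := Form V

instance : Ring (ConjForm V) := inferInstanceAs (Ring (Form V))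

instance : Algebra ℂ (ConjForm V) :=
  RingHom.toAlgebra' (S := ConjForm V) ((algebraMap ℂ (Form V)).comp (starRingEnd ℂ))
    (fun c x => Algebra.commutes (A := Form V) (conj c) x)

theorem ConjForm.smul_def (c : ℂ) (x : Form V) :
    (c • (show ConjForm V from x) : ConjForm V) = (conj c • x : Form V) :=
  (Algebra.smul_def (A := Form V) (conj c) x).symm

/-- Complex conjugation of forms: the conjugate-linear ring endomorphism that conjugates covectors
pointwise. -/
def conjForm : Form V →+* Form V :=
  ((ExteriorAlgebra.lift ℂ (M := Covector V) (A := ConjForm V))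
    ⟨{ toFun := fun a => (ExteriorAlgebra.ι ℂ (conjCovector a) : Form V)
       map_add' := fun a a' => by
         have h : conjCovector (a + a') = conjCovector a + conjCovector a' := by
           ext x; simp
         rw [h, map_add]; rfl
       map_smul' := fun c a => by
         have h : conjCovector (c • a) = conj c • conjCovector a := by
           ext x; simp
         rw [h, map_smul]
         exact (ConjForm.smul_def V c _).symm },
     fun a => ExteriorAlgebra.ι_sq_zero (R := ℂ) (conjCovector a)⟩ : Form V →ₐ[ℂ] ConjForm V).toRingHom

theorem conjForm_ι (a : Covector V) :
    conjForm V (ExteriorAlgebra.ι ℂ a) = ExteriorAlgebra.ι ℂ (conjCovector a) :=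
  ExteriorAlgebra.lift_ι_apply (R := ℂ) (A := ConjForm V) _ _ a

theorem conjForm_smul (c : ℂ) (u : Form V) : conjForm V (c • u) = conj c • conjForm V u :=
  (map_smul (ExteriorAlgebra.lift ℂ (M := Covector V) (A := ConjForm V) _) c u).trans
    (ConjForm.smul_def V c _)

variable {V} in
/-- The covector `dz : x ↦ ⟪e, x⟫`, the complex coordinate along a unit vector `e`. -/
def dz (e : V) : Covector V := (innerₛₗ ℂ e).restrictScalars ℝ

/-! ### The Hermitian inner product on forms -/

variable [FiniteDimensional ℂ V]

/-- The real basis `(f_j, i f_j)_j` of `V`, where `(f_j)_j` is a unitary basis; it is orthonormal for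
the Euclidean inner product `Re ⟪x, y⟫`. -/
def realFrame : Module.Basis (Fin 2 ×ₗ Fin (Module.finrank ℂ V)) ℝ V :=
  (Complex.basisOneI.smulTower (stdOrthonormalBasis ℂ V).toBasis).reindex toLex

/-- The coframe `(dx_j, dy_j)_j` dual to `realFrame`, as a complex basis of the complexified
dual. -/
def coframe : Module.Basis (Fin 2 ×ₗ Fin (Module.finrank ℂ V)) ℂ (Covector V) :=
  Module.Basis.ofEquivFun ((realFrame V).constr ℂ).symm

/-- The Hermitian inner product on forms induced by that of `V`: the wedge products of distinct
members of the orthonormal coframe are orthonormal. It is conjugate-linear in the first argument.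
The theorems `inner_ι_ι`, `inner_ιMulti` and `inner_ιMulti_of_ne` describe it without reference to
the coframe. -/
@[reducible]
def formCore : InnerProductSpace.Core ℂ (Form V) where
  inner u v := ∑ s, conj ((coframe V).ExteriorAlgebra.repr u s) *
    (coframe V).ExteriorAlgebra.repr v s
  conj_inner_symm u v := by
    simp [mul_comm]
  re_inner_nonneg u := by
    simp only [← Complex.normSq_eq_conj_mul_self, map_sum]
    exact Finset.sum_nonneg fun s _ => by simpa using Complex.normSq_nonneg _
  add_left u v w := by
    simp [add_mul, Finset.sum_add_distrib]
  smul_left u v c := by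
    simp [Finset.mul_sum, mul_assoc]
  definite u h := by
    simp only [← Complex.normSq_eq_conj_mul_self] at h
    rw [← Complex.ofReal_sum, Complex.ofReal_eq_zero,
      Finset.sum_eq_zero_iff_of_nonneg fun s _ => Complex.normSq_nonneg _] at h
    refine (coframe V).ExteriorAlgebra.ext_elem fun s => ?_
    simpa using h s (Finset.mem_univ s)

instance : NormedAddCommGroup (Form V) := (formCore V).toNormedAddCommGroup

instance : InnerProductSpace ℂ (Form V) := InnerProductSpace.ofCore (formCore V).toCore

instance : FiniteDimensional ℂ (Form V) :=
  Module.Basis.finiteDimensional_of_finite (coframe V).ExteriorAlgebra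

theorem inner_basis (s t : Finset (Fin 2 ×ₗ Fin (Module.finrank ℂ V))) :
    inner ℂ ((coframe V).ExteriorAlgebra s) ((coframe V).ExteriorAlgebra t) =
      if s = t then (1 : ℂ) else 0 := by
  change ∑ r, conj ((coframe V).ExteriorAlgebra.repr ((coframe V).ExteriorAlgebra s) r) *
    (coframe V).ExteriorAlgebra.repr ((coframe V).ExteriorAlgebra t) r = _
  simp [Finsupp.single_apply]

theorem coframe_apply_realFrame (i j : Fin 2 ×ₗ Fin (Module.finrank ℂ V)) :
    coframe V i (realFrame V j) = if i = j then 1 else 0 := by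
  simp [coframe, Pi.single_apply, eq_comm]

theorem ιMulti_coframe {k : ℕ} (t : Fin k ↪o Fin 2 ×ₗ Fin (Module.finrank ℂ V)) :
    ExteriorAlgebra.ιMulti ℂ k (fun i => coframe V (t i)) =
      (coframe V).ExteriorAlgebra (Finset.univ.map t.toEmbedding) := by
  have h := ExteriorAlgebra.basis_apply_powersetCard (coframe V)
    (Set.powersetCard.ofFinEmbEquiv t)
  rw [ExteriorAlgebra.ιMulti_family, Equiv.symm_apply_apply] at h
  exact h.symm

theorem alternating_ext {k : ℕ} {f g : Covector V [⋀^Fin k]→ₗ[ℂ] ℂ}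
    (h : ∀ t : Fin k ↪o Fin 2 ×ₗ Fin (Module.finrank ℂ V),
      f (fun i => coframe V (t i)) = g (fun i => coframe V (t i))) : f = g := by
  refine Module.Basis.ext_alternating (coframe V) fun s hs => ?_
  have hm : StrictMono (s ∘ Tuple.sort s) :=
    (Tuple.monotone_sort s).strictMono_of_injective (hs.comp (Tuple.sort s).injective)
  have h1 := h (OrderEmbedding.ofStrictMono _ hm)
  have h2 := f.map_perm (fun i => coframe V (s i)) (Tuple.sort s)
  have h3 := g.map_perm (fun i => coframe V (s i)) (Tuple.sort s)
  have h4 : Equiv.Perm.sign (Tuple.sort s) • f (fun i => coframe V (s i)) =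
      Equiv.Perm.sign (Tuple.sort s) • g (fun i => coframe V (s i)) := by
    rw [← h2, ← h3]; exact h1
  exact smul_left_cancel _ h4

theorem inner_ι_coframe (i j : Fin 2 ×ₗ Fin (Module.finrank ℂ V)) :
    inner ℂ (ExteriorAlgebra.ι ℂ (coframe V i)) (ExteriorAlgebra.ι ℂ (coframe V j)) =
      if i = j then (1 : ℂ) else 0 := by
  have h : ∀ i, ExteriorAlgebra.ι ℂ (coframe V i) = (coframe V).ExteriorAlgebra {i} := by
    intro i
    have := ιMulti_coframe V (k := 1) (OrderEmbedding.ofStrictMono (fun _ => i)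
      (fun a b hab => absurd (Subsingleton.elim a b) hab.ne))
    rw [ExteriorAlgebra.ιMulti_apply] at this
    simp only [List.ofFn_succ, List.ofFn_zero, List.prod_singleton, Finset.univ_unique,
      Finset.map_singleton] at this
    exact this
  rw [h, h, inner_basis]
  simp

/-- The inner product of decomposable forms is the Gram determinant. -/
theorem inner_ιMulti {k : ℕ} (a c : Fin k → Covector V) :
    inner ℂ (ExteriorAlgebra.ιMulti ℂ k a) (ExteriorAlgebra.ιMulti ℂ k c) =
      (Matrix.of fun i j =>
        (inner ℂ (ExteriorAlgebra.ι ℂ (a j)) (ExteriorAlgebra.ι ℂ (c i)) : ℂ)).det := by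
  let P (a : Fin k → Covector V) : Covector V [⋀^Fin k]→ₗ[ℂ] ℂ :=
    (innerₛₗ ℂ (ExteriorAlgebra.ιMulti ℂ k a)).compAlternatingMap (ExteriorAlgebra.ιMulti ℂ k)
  let D (a : Fin k → Covector V) : Covector V [⋀^Fin k]→ₗ[ℂ] ℂ :=
    Matrix.detRowAlternating.compLinearMap
      (LinearMap.pi fun j => (innerₛₗ ℂ (ExteriorAlgebra.ι ℂ (a j))) ∘ₗ ExteriorAlgebra.ι ℂ)
  have hP : ∀ a c, P a c =
    inner ℂ (ExteriorAlgebra.ιMulti ℂ k a) (ExteriorAlgebra.ιMulti ℂ k c) := fun _ _ => rfl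
  have hD : ∀ a c, D a c = (Matrix.of fun i j =>
        (inner ℂ (ExteriorAlgebra.ι ℂ (a j)) (ExteriorAlgebra.ι ℂ (c i)) : ℂ)).det :=
    fun _ _ => rfl
  have hPs : ∀ a c, P a c = conj (P c a) := fun a c => by
    rw [hP, hP, inner_conj_symm]
  have hDs : ∀ a c, D a c = conj (D c a) := fun a c => by
    rw [hD, hD, RingHom.map_det, ← Matrix.det_transpose]
    congr 1
    ext i j
    simp
  have key : ∀ a, P a = D a := fun a => alternating_ext V fun t => by
    rw [hPs, hDs]
    congr 1
    refine congrFun (congrArg DFunLike.coe (alternating_ext V fun s => ?_)) a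
    rw [hP, hD, ιMulti_coframe, ιMulti_coframe, inner_basis]
    simp only [inner_ι_coframe]
    rw [det_delta]
  rw [← hP, ← hD, key]

/-- Forms of different degrees are orthogonal. -/
theorem inner_ιMulti_of_ne {k m : ℕ} (h : k ≠ m) (a : Fin k → Covector V) (c : Fin m → Covector V) :
    inner ℂ (ExteriorAlgebra.ιMulti ℂ k a) (ExteriorAlgebra.ιMulti ℂ m c) = (0 : ℂ) := by
  have key : ∀ {k m : ℕ} (_ : k ≠ m) (a : Fin k → Covector V),
      (∀ t : Fin m ↪o Fin 2 ×ₗ Fin (Module.finrank ℂ V), inner ℂ (ExteriorAlgebra.ιMulti ℂ k a)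
        (ExteriorAlgebra.ιMulti ℂ m fun i => coframe V (t i)) = (0 : ℂ)) →
      ∀ c : Fin m → Covector V,
        inner ℂ (ExteriorAlgebra.ιMulti ℂ k a) (ExteriorAlgebra.ιMulti ℂ m c) = (0 : ℂ) := by
    intro k m _ a ht c
    exact congrFun (congrArg DFunLike.coe (alternating_ext V
      (f := (innerₛₗ ℂ (ExteriorAlgebra.ιMulti ℂ k a)).compAlternatingMap
        (ExteriorAlgebra.ιMulti ℂ m)) (g := 0) ht)) c
  refine key h a (fun t => ?_) c
  rw [← inner_conj_symm, map_eq_zero]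
  refine key h.symm _ (fun s => ?_) a
  rw [ιMulti_coframe, ιMulti_coframe, inner_basis, if_neg]
  intro e
  exact h (by simpa using (congrArg Finset.card e).symm)

theorem sum_linear_eq {ι κ : Type*} [Fintype ι] [Fintype κ] (f : OrthonormalBasis ι ℂ V)
    (e : OrthonormalBasis κ ℂ V) (F G : V →ₗ[ℂ] ℂ) :
    ∑ j, conj (F (f j)) * G (f j) = ∑ j, conj (F (e j)) * G (e j) := by
  have := FiniteDimensional.complete ℂ V
  have hr : ∀ F : V →ₗ[ℂ] ℂ, ∃ v, ∀ x, F x = inner ℂ v x := fun F =>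
    ⟨(InnerProductSpace.toDual ℂ V).symm (LinearMap.toContinuousLinearMap F), fun x => by
      simp⟩
  obtain ⟨v, hv⟩ := hr F
  obtain ⟨w, hw⟩ := hr G
  simp only [hv, hw, inner_conj_symm]
  simp_rw [mul_comm]
  rw [f.sum_inner_mul_inner, e.sum_inner_mul_inner]

/-- The inner product of covectors, in terms of any unitary basis `(f_j)_j` of `V`. -/
theorem inner_ι_ι {ι : Type*} [Fintype ι] (f : OrthonormalBasis ι ℂ V) (a c : Covector V) :
    inner ℂ (ExteriorAlgebra.ι ℂ a) (ExteriorAlgebra.ι ℂ c) =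
      ∑ j, (conj (a (f j)) * c (f j) + conj (a (Complex.I • f j)) * c (Complex.I • f j)) := by
  have h1 : inner ℂ (ExteriorAlgebra.ι ℂ a) (ExteriorAlgebra.ι ℂ c) =
      ∑ i, conj (a (realFrame V i)) * c (realFrame V i) := by
    have hx : ∀ a : Covector V, ExteriorAlgebra.ι ℂ a =
        ∑ i, a (realFrame V i) • ExteriorAlgebra.ι ℂ (coframe V i) := by
      intro a
      conv_lhs => rw [← (coframe V).sum_repr a]
      simp only [map_sum, map_smul]
      rfl
    rw [hx a, hx c]
    simp [inner_ι_coframe, mul_comm]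
  have h2 : ∑ i, conj (a (realFrame V i)) * c (realFrame V i) =
      ∑ j, (conj (a (stdOrthonormalBasis ℂ V j)) * c (stdOrthonormalBasis ℂ V j) +
        conj (a (Complex.I • stdOrthonormalBasis ℂ V j)) *
          c (Complex.I • stdOrthonormalBasis ℂ V j)) := by
    rw [← toLex.sum_comp, Fintype.sum_prod_type, Fin.sum_univ_two, Finset.sum_add_distrib]
    simp [realFrame]
  have hI : ∀ x : V, Complex.I • Complex.I • x = -x := fun x => by
    rw [smul_smul, Complex.I_mul_I, neg_one_smul]
  have hz : ∀ (a : Covector V) (z : ℂ) (x : V),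
      a (z • x) = (z.re : ℂ) * a x + (z.im : ℂ) * a (Complex.I • x) := fun a z x => by
    conv_lhs => rw [← Complex.re_add_im z, add_smul, mul_smul, map_add,
      Complex.coe_smul, map_smul, Complex.coe_smul, map_smul]
    simp
  have hdec : ∀ a : Covector V, ∃ A B : V →ₗ[ℂ] ℂ, ∀ x, a x = A x + conj (B x) ∧
      a (Complex.I • x) = Complex.I * A x - Complex.I * conj (B x) := by
    intro a
    refine ⟨{ toFun := fun x => (a x - Complex.I * a (Complex.I • x)) / 2
              map_add' := fun x y => by simp only [smul_add, map_add]; ring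
              map_smul' := fun z x => ?_ },
            { toFun := fun x => conj ((a x + Complex.I * a (Complex.I • x)) / 2)
              map_add' := fun x y => by rw [← map_add, smul_add, map_add, map_add]; congr 1; ring
              map_smul' := fun z x => ?_ }, fun x => ⟨?_, ?_⟩⟩
    · rw [smul_comm Complex.I z x, hz a z x, hz a z (Complex.I • x), hI, map_neg, RingHom.id_apply,
        smul_eq_mul]
      conv_rhs => rw [← Complex.re_add_im z]
      linear_combination ((z.im : ℂ) * a (Complex.I • x) / 2) * Complex.I_sq
    · rw [smul_comm Complex.I z x, hz a z x, hz a z (Complex.I • x), hI, map_neg, RingHom.id_apply,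
        smul_eq_mul]
      apply (starRingEnd ℂ).injective
      rw [map_mul, Complex.conj_conj, Complex.conj_conj]
      have : conj z = (z.re : ℂ) - z.im * Complex.I := by
        conv_lhs => rw [← Complex.re_add_im z]
        simp only [map_add, map_mul, Complex.conj_ofReal, Complex.conj_I]
        ring
      rw [this]
      linear_combination ((z.im : ℂ) * a (Complex.I • x) / 2) * Complex.I_sq
    · simp only [LinearMap.coe_mk, AddHom.coe_mk, Complex.conj_conj]
      ring
    · simp only [LinearMap.coe_mk, AddHom.coe_mk, Complex.conj_conj]
      linear_combination a (Complex.I • x) * Complex.I_sq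
  obtain ⟨A, B, ha⟩ := hdec a
  obtain ⟨A', B', hc⟩ := hdec c
  have hterm : ∀ x : V, conj (a x) * c x + conj (a (Complex.I • x)) * c (Complex.I • x) =
      2 * (conj (A x) * A' x + conj (B' x) * B x) := by
    intro x
    rw [(ha x).1, (ha x).2, (hc x).1, (hc x).2]
    simp only [map_add, map_sub, map_mul, Complex.conj_conj, Complex.conj_I]
    linear_combination (-(conj (A x) - B x) * (A' x - conj (B' x))) * Complex.I_sq
  rw [h1, h2]
  simp only [hterm, ← Finset.mul_sum, Finset.sum_add_distrib]
  rw [sum_linear_eq V f (stdOrthonormalBasis ℂ V) A A',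
    sum_linear_eq V f (stdOrthonormalBasis ℂ V) B' B]

/-! ### The Lefschetz operators -/

/-- The fundamental form `ω = (i/2) ∑ dz_j ∧ dz̄_j`, where `(z_j)_j` are the coordinates of a unitary
basis; by `fundamentalForm_eq` it does not depend on the unitary basis. -/
def fundamentalForm : Form V :=
  (Complex.I / 2) • ∑ j, ExteriorAlgebra.ι ℂ (dz (stdOrthonormalBasis ℂ V j)) *
    ExteriorAlgebra.ι ℂ (conjCovector (dz (stdOrthonormalBasis ℂ V j)))

theorem fundamentalForm_eq {ι : Type*} [Fintype ι] (f : OrthonormalBasis ι ℂ V) :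
    fundamentalForm V = (Complex.I / 2) • ∑ j, ExteriorAlgebra.ι ℂ (dz (f j)) *
      ExteriorAlgebra.ι ℂ (conjCovector (dz (f j))) := by
  classical
  rw [fundamentalForm]
  congr 1
  set e := stdOrthonormalBasis ℂ V
  have h1 : ∀ j, dz (e j) = ∑ k, (inner ℂ (e j) (f k) : ℂ) • dz (f k) := fun j => by
    ext x
    simp [dz, LinearMap.sum_apply, f.sum_inner_mul_inner]
  have h2 : ∀ j, conjCovector (dz (e j)) =
      ∑ l, (inner ℂ (f l) (e j) : ℂ) • conjCovector (dz (f l)) := fun j => by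
    rw [h1]
    ext x
    simp [LinearMap.sum_apply]
  have h3 : ∀ j, ExteriorAlgebra.ι ℂ (dz (e j)) * ExteriorAlgebra.ι ℂ (conjCovector (dz (e j))) =
      ∑ k, ∑ l, ((inner ℂ (f l) (e j) : ℂ) * inner ℂ (e j) (f k)) •
        (ExteriorAlgebra.ι ℂ (dz (f k)) * ExteriorAlgebra.ι ℂ (conjCovector (dz (f l)))) :=
    fun j => by
      rw [h2, h1]
      simp only [map_sum, map_smul, Finset.sum_mul, Finset.mul_sum, smul_mul_assoc,
        mul_smul_comm, Finset.smul_sum, smul_smul]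
      rw [Finset.sum_comm]
  simp only [h3]
  rw [Finset.sum_comm]
  refine Finset.sum_congr rfl fun k _ => ?_
  rw [Finset.sum_comm]
  simp only [← Finset.sum_smul, e.sum_inner_mul_inner, f.inner_eq_ite]
  simp

/-- The Lefschetz operator `L u = ω ∧ u`. -/
def lefschetz : Module.End ℂ (Form V) :=
  LinearMap.mulLeft ℂ (fundamentalForm V)

/-- The operator `Λ`, the adjoint of the Lefschetz operator. -/
def lefschetzAdjoint : Module.End ℂ (Form V) :=
  LinearMap.adjoint (lefschetz V)

/-- The orthogonal projection onto the `(p,q)`-forms. -/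
def typeProj (p q : ℕ) : Module.End ℂ (Form V) :=
  ((formsOfType V p q).starProjection : Form V →L[ℂ] Form V).toLinearMap

/-- The operator `𝐈 = ∑_{p,q} i^{p-q} π_{p,q}`; there are no nonzero `(p,q)`-forms unless
`p, q ≤ n`. -/
def weilOp : Module.End ℂ (Form V) :=
  ∑ p ∈ Finset.range (Module.finrank ℂ V + 1), ∑ q ∈ Finset.range (Module.finrank ℂ V + 1),
    (Complex.I ^ ((p : ℤ) - (q : ℤ))) • typeProj V p q

end HermForm

end

noncomputable section

namespace HermForm

/-! ### Combinatorics of finite sets -/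

section Combinatorics

open Finset

variable {ι : Type*} [DecidableEq ι]

/-! Both sides are linear in `u` and conjugate-linear in `v`, so it suffices to test them on a
spanning set of forms on which every operator is explicit. For a unitary basis put `vol e j` = (i/2)
dz_j ∧ dz̄_j and take the monomials dz_A ∧ dz̄_B ∧ vol_M with A, B, M pairwise disjoint. They are
orthogonal, of squared norm 2^(|A|+|B|) (`inner_mono`). The elements vol_j are central with square
zero, and ω is their sum. Hence ω^[k] is the sum of vol_S over |S| = k (`dpow_fundamentalForm`), and
Λ^[l] removes l-element subsets S from M (`dpow_lefschetzAdjoint_mono`). Conjugation exchanges A and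
B up to a sign.

In top degree, the product of dz_A ∧ dz̄_B ∧ vol_{M∖S}, dz_B' ∧ dz̄_A' ∧ vol_{M'∖S'} and the power
of ω vanishes unless A = A', B = B' and M∖S, M'∖S' are disjoint. Otherwise it is a constant,
independent of l, S, S', times the volume form. What remains is to count disjoint pairs, weighted by
(-1)^l b_l. With m = |M| = |M'|, inclusion–exclusion over D ⊆ M ∩ M' turns the count into ∑_D
(-1)^|D| C(m-|D|, l)². The recursion defining b_l then kills every D with |D| < m. A term survives
only if D = M = M', and it equals (-1)^m (`sum_b_card_disjoint`). This is the orthogonality of the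
monomials; the powers of i and the signs are compared in `conj_I_zpow_mul`. -/

/-- Each set T of size k + 1 arises from exactly k + 1 pairs, one for each j in T. This factor
cancels against the 1/(k + 1) in `dpow_succ`, both for ω and for Λ. -/
theorem sum_powersetCard_sum_insert {R : Type*} [AddCommMonoid R] (M : Finset ι) (k : ℕ)
    (f : Finset ι → R) :
    ∑ S ∈ powersetCard k M, ∑ j ∈ M \ S, f (insert j S) =
      (k + 1) • ∑ S ∈ powersetCard (k + 1) M, f S := by
  have h : ∑ S ∈ powersetCard (k + 1) M, ∑ j ∈ S, f S =
      (k + 1) • ∑ S ∈ powersetCard (k + 1) M, f S := by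
    rw [smul_sum]
    refine sum_congr rfl fun S hS => ?_
    rw [sum_const, (mem_powersetCard.1 hS).2]
  rw [← h, sum_sigma', sum_sigma']
  refine sum_bij' (fun x _ => ⟨insert x.2 x.1, x.2⟩) (fun x _ => ⟨x.1.erase x.2, x.2⟩) ?_ ?_ ?_ ?_ ?_
  · rintro ⟨S, j⟩ hx
    simp only [mem_sigma, mem_powersetCard, mem_sdiff] at hx ⊢
    exact ⟨⟨insert_subset hx.2.1 hx.1.1, by rw [card_insert_of_notMem hx.2.2, hx.1.2]⟩,
      mem_insert_self _ _⟩
  · rintro ⟨S, j⟩ hx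
    simp only [mem_sigma, mem_powersetCard, mem_sdiff] at hx ⊢
    exact ⟨⟨(erase_subset _ _).trans hx.1.1, by rw [card_erase_of_mem hx.2, hx.1.2]; rfl⟩,
      hx.1.1 hx.2, notMem_erase _ _⟩
  · rintro ⟨S, j⟩ hx
    simp only [mem_sigma, mem_powersetCard, mem_sdiff] at hx
    simp [erase_insert hx.2.2]
  · rintro ⟨S, j⟩ hx
    simp only [mem_sigma] at hx
    simp [insert_erase hx.2]
  · intros; rfl

/-- The binomials vanish for l > m, so the recursion holds over a common range of summation that
does not depend on m. -/
theorem sum_b_choose_sq {m N : ℕ} (h : m ≤ N) :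
    ∑ l ∈ range (N + 1), (-1) ^ l * (m.choose l : ℤ) ^ 2 * b l = if m = 0 then 1 else 0 := by
  have h1 : ∑ l ∈ range (N + 1), (-1) ^ l * (m.choose l : ℤ) ^ 2 * b l =
      ∑ l ∈ range (m + 1), (-1) ^ l * (m.choose l : ℤ) ^ 2 * b l := by
    refine (sum_subset (range_mono (by omega)) fun l _ hl => ?_).symm
    rw [Nat.choose_eq_zero_of_lt (by simpa using hl)]
    simp
  rw [h1]
  split_ifs with hm
  · subst hm; simp [b_zero]
  · exact sum_b_eq_zero m (by omega)

/-- The combinatorial core: the weights b_l are exactly those that invert the count of disjoint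
complements. -/
theorem sum_b_card_disjoint {M M' : Finset ι} (hM : M.card = M'.card) {N : ℕ} (hN : M.card ≤ N) :
    ∑ l ∈ range (N + 1), (-1) ^ l * b l * ∑ S ∈ powersetCard l M, ∑ S' ∈ powersetCard l M',
      (if Disjoint (M \ S) (M' \ S') then (1 : ℤ) else 0) =
    if M = M' then (-1) ^ M.card else 0 := by
  have h1 : ∀ l, ∑ S ∈ powersetCard l M, ∑ S' ∈ powersetCard l M',
      (if Disjoint (M \ S) (M' \ S') then (1 : ℤ) else 0) =
      ∑ D ∈ (M ∩ M').powerset, (-1) ^ D.card * ((M.card - D.card).choose l : ℤ) ^ 2 := by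
    intro l
    have h2 : ∀ S S' : Finset ι, (if Disjoint (M \ S) (M' \ S') then (1 : ℤ) else 0) =
        ∑ D ∈ (M ∩ M').powerset, (-1) ^ D.card *
          ((if Disjoint D S then 1 else 0) * if Disjoint D S' then 1 else 0) := by
      intro S S'
      -- The alternating sum over all subsets D of a finite set detects whether it is empty; here
      -- the set is (M∖S) ∩ (M'∖S').
      have h3 := sum_powerset_neg_one_pow_card (x := (M \ S) ∩ (M' \ S'))
      simp only [← disjoint_iff_inter_eq_empty] at h3
      rw [← h3]
      have h4 : ((M \ S) ∩ (M' \ S')).powerset =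
          (M ∩ M').powerset.filter fun D => Disjoint D S ∧ Disjoint D S' := by
        ext D
        simp only [mem_powerset, mem_filter, subset_inter_iff, subset_sdiff]
        tauto
      rw [h4, sum_filter]
      refine sum_congr rfl fun D _ => ?_
      split_ifs <;> simp_all
    simp only [h2]
    have h5 : ∀ {K D : Finset ι}, D ⊆ K → ∑ S ∈ powersetCard l K,
        (if Disjoint D S then (1 : ℤ) else 0) = ((K.card - D.card).choose l : ℤ) := by
      intro K D hD
      rw [← sum_filter, sum_const, nsmul_one, ← card_sdiff_of_subset hD, ← card_powersetCard]
      congr 2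
      ext S
      simp only [mem_filter, mem_powersetCard, subset_sdiff, disjoint_comm (a := D)]
      tauto
    calc _ = ∑ D ∈ (M ∩ M').powerset, ∑ S ∈ powersetCard l M, ∑ S' ∈ powersetCard l M',
          (-1) ^ D.card * ((if Disjoint D S then 1 else 0) * if Disjoint D S' then (1 : ℤ) else 0) := by
          exact (sum_congr rfl fun S _ => sum_comm).trans sum_comm
      _ = _ := by
          refine sum_congr rfl fun D hD => ?_
          obtain ⟨hD1, hD2⟩ := subset_inter_iff.1 (mem_powerset.1 hD)
          simp only [← mul_sum, ← sum_mul]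
          rw [h5 hD1, h5 hD2, ← hM, sq]
  simp only [h1, mul_sum]
  rw [sum_comm]
  have h6 : ∀ D ∈ (M ∩ M').powerset, ∑ l ∈ range (N + 1),
      (-1) ^ l * b l * ((-1) ^ D.card * ((M.card - D.card).choose l : ℤ) ^ 2) =
      if D = M then (-1) ^ M.card else 0 := by
    intro D hD
    obtain ⟨hD1, -⟩ := subset_inter_iff.1 (mem_powerset.1 hD)
    have h7 := sum_b_choose_sq (m := M.card - D.card) (N := N) (by omega)
    have h8 : M.card - D.card = 0 ↔ D = M := by
      refine ⟨fun h => eq_of_subset_of_card_le hD1 (by omega), fun h => by simp [h]⟩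
    simp only [h8] at h7
    calc _ = (-1) ^ D.card * ∑ l ∈ range (N + 1),
          (-1) ^ l * ((M.card - D.card).choose l : ℤ) ^ 2 * b l := by
          rw [mul_sum]; exact sum_congr rfl fun l _ => by ring
      _ = _ := by
          rw [h7]; split_ifs with h
          · rw [h, mul_one]
          · rw [mul_zero]
  rw [sum_congr rfl h6, sum_ite_eq']
  have h9 : M ∈ (M ∩ M').powerset ↔ M = M' := by
    rw [mem_powerset, subset_inter_iff]
    exact ⟨fun h => eq_of_subset_of_card_le h.2 hM.ge, fun h => by simp [h]⟩
  simp only [h9]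

end Combinatorics

/-! ### Words in a unitary coframe -/

section Words

variable {V : Type*} [NormedAddCommGroup V] [InnerProductSpace ℂ V]
  {ι : Type*} [Fintype ι] (e : OrthonormalBasis ι ℂ V)

/-- The covectors `dz_j` (indexed by `inl j`) and `dz̄_j` (indexed by `inr j`) of a unitary basis. -/
def cov : ι ⊕ ι → Covector V :=
  Sum.elim (fun j => dz (e j)) (fun j => conjCovector (dz (e j)))

/-- The one-forms `dz_j` and `dz̄_j`. -/
def gen (i : ι ⊕ ι) : Form V := ExteriorAlgebra.ι ℂ (cov e i)

/-- The wedge product of the one-forms listed in `L`. -/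
def word (L : List (ι ⊕ ι)) : Form V := (L.map (gen e)).prod

@[simp] theorem word_nil : word e [] = 1 := rfl

@[simp] theorem word_cons (i : ι ⊕ ι) (L : List (ι ⊕ ι)) :
    word e (i :: L) = gen e i * word e L := by simp [word]

theorem word_append (L K : List (ι ⊕ ι)) : word e (L ++ K) = word e L * word e K := by
  simp [word]

theorem ι_mul_ι_comm (a c : Covector V) :
    (ExteriorAlgebra.ι ℂ a * ExteriorAlgebra.ι ℂ c : Form V) =
      -(ExteriorAlgebra.ι ℂ c * ExteriorAlgebra.ι ℂ a) :=
  eq_neg_of_add_eq_zero_left (ExteriorAlgebra.ι_add_mul_swap a c)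

theorem gen_mul_gen_comm (i j : ι ⊕ ι) : gen e i * gen e j = -(gen e j * gen e i) :=
  ι_mul_ι_comm _ _

theorem gen_mul_self (i : ι ⊕ ι) : gen e i * gen e i = 0 := ExteriorAlgebra.ι_sq_zero _

/-- The sign is left undetermined, since the lemma serves only vanishing and span statements. -/
theorem word_perm {L K : List (ι ⊕ ι)} (h : L.Perm K) :
    word e L = word e K ∨ word e L = -word e K := by
  induction h with
  | nil => exact Or.inl rfl
  | cons i _ ih => rcases ih with ih | ih <;> simp [ih]
  | swap i j L =>
    right
    simp only [word_cons, ← mul_assoc, gen_mul_gen_comm e j i, neg_mul]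
  | trans _ _ h1 h2 => rcases h1 with h1 | h1 <;> rcases h2 with h2 | h2 <;> simp [h1, h2]

/-- A repeated letter can be moved to the front in both copies, where its square vanishes. -/
theorem word_eq_zero {L : List (ι ⊕ ι)} (h : ¬L.Nodup) : word e L = 0 := by
  obtain ⟨i, hi⟩ := List.exists_duplicate_iff_not_nodup.2 h
  obtain ⟨K, hK⟩ := (List.duplicate_iff_sublist.1 hi).exists_perm_append
  have h0 : word e ([i, i] ++ K) = 0 := by
    simp [← mul_assoc, gen_mul_self]
  rcases word_perm e hK with h | h <;> rw [h, h0]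
  exact neg_zero

theorem gen_mul_word (i : ι ⊕ ι) (L : List (ι ⊕ ι)) :
    gen e i * word e L = (-1 : ℂ) ^ L.length • (word e L * gen e i) := by
  induction L with
  | nil => simp
  | cons j L ih =>
    rw [word_cons, ← mul_assoc, gen_mul_gen_comm, neg_mul, mul_assoc, ih, mul_smul_comm,
      List.length_cons, pow_succ, mul_neg_one, neg_smul, mul_assoc]

theorem word_mul_word_comm (L K : List (ι ⊕ ι)) :
    word e L * word e K = (-1 : ℂ) ^ (L.length * K.length) • (word e K * word e L) := by
  induction L with
  | nil => simp
  | cons i L ih =>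
    rw [word_cons, mul_assoc, ih, mul_smul_comm, ← mul_assoc, gen_mul_word, smul_mul_assoc,
      smul_smul, mul_assoc, ← pow_add, List.length_cons]
    congr 2
    ring

theorem word_eq_ιMulti (L : List (ι ⊕ ι)) :
    word e L = ExteriorAlgebra.ιMulti ℂ L.length (fun i => cov e (L.get i)) := by
  rw [ExteriorAlgebra.ιMulti_apply, word]
  congr 1
  conv_lhs => rw [← List.ofFn_get L, List.map_ofFn]
  rfl

theorem conjForm_gen (i : ι ⊕ ι) : conjForm V (gen e i) = gen e i.swap := by
  rw [gen, conjForm_ι, gen]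
  congr 1
  rcases i with j | j
  · rfl
  · ext x; simp [cov]

theorem conjForm_word (L : List (ι ⊕ ι)) :
    conjForm V (word e L) = word e (L.map Sum.swap) := by
  induction L with
  | nil => simp
  | cons i L ih => rw [word_cons, map_mul, ih, conjForm_gen, List.map_cons, word_cons]

/-- The coefficients are the values at e_j of the complex-linear and conjugate-linear parts of `a`;
one of the two vanishes when `a` has pure type. -/
theorem covector_eq_sum (a : Covector V) :
    a = ∑ j, (((a (e j) - Complex.I * a (Complex.I • e j)) / 2) • cov e (Sum.inl j) +
      ((a (e j) + Complex.I * a (Complex.I • e j)) / 2) • cov e (Sum.inr j)) := by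
  have hz : ∀ (z : ℂ) (x : V),
      a (z • x) = (z.re : ℂ) * a x + (z.im : ℂ) * a (Complex.I • x) := fun z x => by
    conv_lhs => rw [← Complex.re_add_im z, add_smul, mul_smul, map_add,
      Complex.coe_smul, map_smul, Complex.coe_smul, map_smul]
    simp
  ext x
  conv_lhs => rw [← e.sum_repr' x, map_sum]
  rw [LinearMap.sum_apply]
  refine Finset.sum_congr rfl fun j _ => ?_
  have h1 : cov e (Sum.inl j) x = inner ℂ (e j) x := rfl
  have h2 : cov e (Sum.inr j) x = conj (inner ℂ (e j) x) := rfl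
  rw [hz, LinearMap.add_apply, LinearMap.smul_apply, LinearMap.smul_apply, h1, h2]
  set z : ℂ := inner ℂ (e j) x
  have h3 : conj z = (z.re : ℂ) - z.im * Complex.I := by
    conv_lhs => rw [← Complex.re_add_im z]
    simp only [map_add, map_mul, Complex.conj_ofReal, Complex.conj_I]
    ring
  rw [h3]
  conv_rhs => rw [← Complex.re_add_im z]
  simp only [smul_eq_mul, Complex.add_re, Complex.add_im, Complex.ofReal_re, Complex.ofReal_im,
    Complex.mul_re, Complex.mul_im, Complex.I_re, Complex.I_im, mul_zero, mul_one, zero_add,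
    sub_zero, add_zero]
  linear_combination (z.im * a (Complex.I • e j)) * Complex.I_sq

theorem covectors10_map_le :
    (covectors10 V).map (ExteriorAlgebra.ι ℂ) ≤
      Submodule.span ℂ (Set.range fun j => gen e (Sum.inl j)) := by
  rintro _ ⟨a, ha, rfl⟩
  rw [covector_eq_sum e a, map_sum]
  refine Submodule.sum_mem _ fun j _ => ?_
  have h : a (e j) + Complex.I * a (Complex.I • e j) = 0 := by
    rw [ha]; linear_combination a (e j) * Complex.I_sq
  rw [h, zero_div, zero_smul, add_zero, map_smul]
  exact Submodule.smul_mem _ _ (Submodule.subset_span ⟨j, rfl⟩)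

theorem covectors01_map_le :
    (covectors01 V).map (ExteriorAlgebra.ι ℂ) ≤
      Submodule.span ℂ (Set.range fun j => gen e (Sum.inr j)) := by
  rintro _ ⟨a, ha, rfl⟩
  rw [covector_eq_sum e a, map_sum]
  refine Submodule.sum_mem _ fun j _ => ?_
  have h : a (e j) - Complex.I * a (Complex.I • e j) = 0 := by
    rw [ha, Complex.conj_I]; linear_combination a (e j) * Complex.I_sq
  rw [h, zero_div, zero_smul, zero_add, map_smul]
  exact Submodule.smul_mem _ _ (Submodule.subset_span ⟨j, rfl⟩)

theorem span_word : Submodule.span ℂ (Set.range (word e)) = ⊤ := by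
  rw [eq_top_iff]
  rintro x -
  induction x using CliffordAlgebra.left_induction with
  | algebraMap r =>
    rw [Algebra.algebraMap_eq_smul_one]
    exact Submodule.smul_mem _ _ (Submodule.subset_span ⟨[], rfl⟩)
  | add x y hx hy => exact Submodule.add_mem _ hx hy
  | ι_mul x m hx =>
    have hg : ∀ i, gen e i * x ∈ Submodule.span ℂ (Set.range (word e)) := fun i => by
      induction hx using Submodule.span_induction with
      | mem _ h =>
        obtain ⟨L, rfl⟩ := h
        exact Submodule.subset_span ⟨i :: L, word_cons e i L⟩
      | zero => simp
      | add _ _ _ _ h1 h2 => rw [mul_add]; exact Submodule.add_mem _ h1 h2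
      | smul c _ _ h => rw [mul_smul_comm]; exact Submodule.smul_mem _ _ h
    change (ExteriorAlgebra.ι ℂ m : Form V) * x ∈ _
    rw [covector_eq_sum e m, map_sum, Finset.sum_mul]
    refine Submodule.sum_mem _ fun j _ => ?_
    rw [map_add, LinearMap.map_smul, LinearMap.map_smul, add_mul, smul_mul_assoc, smul_mul_assoc]
    exact Submodule.add_mem _ (Submodule.smul_mem _ _ (hg _)) (Submodule.smul_mem _ _ (hg _))

open scoped Pointwise in
/-- Forms of type `(p,q)` are combinations of words in `p` letters `dz_j` and `q` letters `dz̄_j`. -/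
theorem formsOfType_le_span_word (p q : ℕ) :
    formsOfType V p q ≤ Submodule.span ℂ {x | ∃ P Q : List ι, P.length = p ∧ Q.length = q ∧
      x = word e (P.map Sum.inl ++ Q.map Sum.inr)} := by
  have hs : ∀ (f : ι → ι ⊕ ι) (p : ℕ), (Set.range fun j => gen e (f j)) ^ p ⊆
      {x | ∃ P : List ι, P.length = p ∧ x = word e (P.map f)} := by
    intro f p
    induction p with
    | zero =>
      rintro x hx
      exact ⟨[], rfl, by simpa using hx⟩
    | succ p ih =>
      rintro x hx
      rw [pow_succ'] at hx
      obtain ⟨_, ⟨j, rfl⟩, y, hy, rfl⟩ := hx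
      obtain ⟨P, hP, rfl⟩ := ih hy
      exact ⟨j :: P, by simp [hP], by simp⟩
  refine (mul_le_mul' (pow_le_pow_left' (covectors10_map_le e) p)
    (pow_le_pow_left' (covectors01_map_le e) q)).trans ?_
  rw [Submodule.span_pow, Submodule.span_pow, Submodule.span_mul_span]
  refine Submodule.span_mono ?_
  rintro _ ⟨x, hx, y, hy, rfl⟩
  obtain ⟨P, hP, rfl⟩ := hs _ _ hx
  obtain ⟨Q, hQ, rfl⟩ := hs _ _ hy
  exact ⟨P, Q, hP, hQ, (word_append e _ _).symm⟩

variable [FiniteDimensional ℂ V]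

/-- Since dz = dx + i dy, the squared norm is 2. For dz_i against dz̄_j the contributions of e_k and
i e_k cancel. -/
theorem inner_gen [DecidableEq ι] (i j : ι ⊕ ι) :
    inner ℂ (gen e i) (gen e j) = if i = j then (2 : ℂ) else 0 := by
  have h : ∀ (z : ℂ) (x : V) (i : ι), dz (e i) (z • x) = z * dz (e i) x := fun z x i => by
    simp [dz]
  have h' : ∀ i j : ι, dz (e i) (e j) = if i = j then 1 else 0 := fun i j => by
    simp [dz, e.inner_eq_ite]
  rw [gen, gen, inner_ι_ι V e]
  have hI : ∀ a c : ℂ, conj (Complex.I * a) * (Complex.I * c) = conj a * c := fun a c => by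
    rw [map_mul, Complex.conj_I]; linear_combination (-conj a * c) * Complex.I_sq
  have hJ : ∀ a c : ℂ, conj (Complex.I * a) * conj (Complex.I * c) = -(conj a * conj c) :=
    fun a c => by
    rw [map_mul, map_mul, Complex.conj_I]; linear_combination (conj a * conj c) * Complex.I_sq
  have hK : ∀ a c : ℂ, Complex.I * a * (Complex.I * c) = -(a * c) := fun a c => by
    linear_combination (a * c) * Complex.I_sq
  have hL : ∀ a c : ℂ, Complex.I * a * conj (Complex.I * c) = a * conj c := fun a c => by
    rw [map_mul, Complex.conj_I]; linear_combination (-a * conj c) * Complex.I_sq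
  rcases i with i | i <;> rcases j with j | j <;>
    simp only [cov, Sum.elim_inl, Sum.elim_inr, conjCovector_apply, h, h', Complex.conj_conj, hI,
      hJ, hK, hL, add_neg_cancel, Finset.sum_const_zero, Sum.inl.injEq, Sum.inr.injEq, reduceCtorEq,
      if_false, ← two_mul, ← Finset.mul_sum] <;>
    simp [apply_ite conj]

theorem inner_word_eq_zero {L K : List (ι ⊕ ι)} {i : ι ⊕ ι} (hL : i ∈ L) (hK : i ∉ K) :
    inner ℂ (word e L) (word e K) = (0 : ℂ) := by
  classical
  by_cases hl : L.length = K.length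
  · have h : ∀ k (hk : K.length = k),
        ExteriorAlgebra.ιMulti ℂ K.length (fun i => cov e (K.get i)) =
        ExteriorAlgebra.ιMulti ℂ k (fun i => cov e (K.get (i.cast hk.symm))) := by
      rintro _ rfl; rfl
    rw [word_eq_ιMulti, word_eq_ιMulti, h _ hl.symm, inner_ιMulti]
    obtain ⟨j, rfl⟩ := List.get_of_mem hL
    -- The letter missing from K is orthogonal to every letter of K, so its column of the Gram
    -- matrix is zero.
    refine Matrix.det_eq_zero_of_column_eq_zero j fun k => ?_
    change inner ℂ (gen e _) (gen e _) = (0 : ℂ)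
    rw [inner_gen, if_neg]
    intro h
    exact hK (h ▸ List.get_mem _ _)
  · rw [word_eq_ιMulti, word_eq_ιMulti, inner_ιMulti_of_ne V hl]

theorem inner_word_self {L : List (ι ⊕ ι)} (h : L.Nodup) :
    inner ℂ (word e L) (word e L) = (2 : ℂ) ^ L.length := by
  classical
  rw [word_eq_ιMulti, inner_ιMulti]
  have : (Matrix.of fun i j : Fin L.length => (inner ℂ (ExteriorAlgebra.ι ℂ (cov e (L.get j)))
      (ExteriorAlgebra.ι ℂ (cov e (L.get i))) : ℂ)) = Matrix.diagonal fun _ => 2 := by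
    ext i j
    change inner ℂ (gen e _) (gen e _) = _
    rw [inner_gen, Matrix.diagonal_apply]
    simp only [h.injective_get.eq_iff, eq_comm]
  rw [this, Matrix.det_diagonal]
  simp

end Words

/-! ### Central volume elements and monomials -/

section Monomials

open Finset

variable {V : Type*} [NormedAddCommGroup V] [InnerProductSpace ℂ V]
  {ι : Type*} [Fintype ι] (e : OrthonormalBasis ι ℂ V)

/-- Moving a covector past two others changes the sign twice. Placing the two-forms in the center, a
commutative ring, makes products over finite sets available. -/
theorem ι_mul_ι_mem_center (a c : Covector V) :
    (ExteriorAlgebra.ι ℂ a * ExteriorAlgebra.ι ℂ c : Form V) ∈ Subalgebra.center ℂ (Form V) := by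
  rw [Subalgebra.mem_center_iff]
  intro x
  induction x using CliffordAlgebra.left_induction with
  | algebraMap r => exact Algebra.commutes r _
  | add x y hx hy => rw [add_mul, mul_add, hx, hy]
  | ι_mul x m hx =>
    change ExteriorAlgebra.ι ℂ m * x * _ = _ * (ExteriorAlgebra.ι ℂ m * x)
    rw [mul_assoc, hx, ← mul_assoc, ← mul_assoc, ← mul_assoc, ι_mul_ι_comm m a, neg_mul, mul_assoc _ _
      (ExteriorAlgebra.ι ℂ c), ι_mul_ι_comm m c, mul_neg, neg_neg, mul_assoc, mul_assoc, mul_assoc,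
      mul_assoc]

/-- The central element `(i/2) dz_j ∧ dz̄_j`. -/
def vol (j : ι) : Subalgebra.center ℂ (Form V) :=
  ⟨(Complex.I / 2) • (gen e (Sum.inl j) * gen e (Sum.inr j)),
    Subalgebra.smul_mem _ (ι_mul_ι_mem_center _ _) _⟩

theorem coe_vol (j : ι) :
    (vol e j : Form V) = (Complex.I / 2) • (gen e (Sum.inl j) * gen e (Sum.inr j)) := rfl

theorem vol_mul_self (j : ι) : vol e j * vol e j = 0 := by
  apply Subtype.ext
  change (vol e j : Form V) * (vol e j : Form V) = 0
  rw [coe_vol, smul_mul_smul_comm, mul_assoc, ← mul_assoc (gen e (Sum.inr j)),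
    gen_mul_gen_comm e (Sum.inr j), neg_mul, mul_neg, ← mul_assoc, ← mul_assoc, gen_mul_self]
  simp

/-- The product of the elements `vol e j` over `j ∈ M`. -/
def volProd (M : Finset ι) : Subalgebra.center ℂ (Form V) := ∏ j ∈ M, vol e j

theorem commute_volProd (M : Finset ι) (x : Form V) : Commute (volProd e M : Form V) x :=
  ((Subalgebra.mem_center_iff.1 (volProd e M).2) x).symm

theorem conjForm_vol (j : ι) : conjForm V (vol e j) = vol e j := by
  rw [coe_vol, conjForm_smul, map_mul, conjForm_gen, conjForm_gen, Sum.swap_inl, Sum.swap_inr,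
    gen_mul_gen_comm, map_div₀, Complex.conj_I, map_ofNat, smul_neg, neg_div, neg_smul, neg_neg]

theorem conjForm_volProd (M : Finset ι) : conjForm V (volProd e M) = volProd e M := by
  classical
  induction M using Finset.induction_on with
  | empty => simp [volProd]
  | insert j M hj ih =>
    have h : (volProd e (insert j M) : Form V) = vol e j * volProd e M := by
      rw [volProd, prod_insert hj]; rfl
    rw [h, map_mul, conjForm_vol, ih]

variable [DecidableEq ι]

theorem vol_mul_volProd_of_mem {j : ι} {M : Finset ι} (h : j ∈ M) :
    vol e j * volProd e M = 0 := by
  rw [volProd, ← mul_prod_erase M _ h, ← mul_assoc, vol_mul_self, zero_mul]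

theorem vol_mul_volProd {j : ι} {M : Finset ι} (h : j ∉ M) :
    vol e j * volProd e M = volProd e (insert j M) := by
  rw [volProd, volProd, prod_insert h]

theorem volProd_mul_volProd (M N : Finset ι) :
    volProd e M * volProd e N = if Disjoint M N then volProd e (M ∪ N) else 0 := by
  split_ifs with h
  · rw [volProd, volProd, volProd, prod_union h]
  · obtain ⟨j, hM, hN⟩ := not_disjoint_iff.1 h
    rw [volProd, ← mul_prod_erase M _ hM, mul_right_comm, vol_mul_volProd_of_mem e hN, zero_mul]

/-- The letters of the word representing `volProd e M` up to a scalar. -/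
def pairs (M : Finset ι) : List (ι ⊕ ι) := M.toList.flatMap fun j => [Sum.inl j, Sum.inr j]

omit [Fintype ι] [DecidableEq ι] in
@[simp] theorem inl_mem_pairs {M : Finset ι} {j : ι} : Sum.inl j ∈ pairs M ↔ j ∈ M := by
  simp [pairs]

omit [Fintype ι] [DecidableEq ι] in
@[simp] theorem inr_mem_pairs {M : Finset ι} {j : ι} : Sum.inr j ∈ pairs M ↔ j ∈ M := by
  simp [pairs]

omit [Fintype ι] [DecidableEq ι] in
theorem nodup_pairs (M : Finset ι) : (pairs M).Nodup := by
  rw [pairs, List.nodup_flatMap]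
  refine ⟨fun j _ => by simp, M.nodup_toList.imp fun {a c} h => ?_⟩
  simp [Function.onFun, List.disjoint_left, h]

omit [Fintype ι] [DecidableEq ι] in
theorem length_pairs (M : Finset ι) : (pairs M).length = 2 * M.card := by
  simp [pairs, mul_comm]

omit [DecidableEq ι] in
theorem coe_volProd (M : Finset ι) :
    (volProd e M : Form V) = (Complex.I / 2) ^ M.card • word e (pairs M) := by
  have h : ∀ L : List ι, (((L.map (vol e)).prod : Subalgebra.center ℂ (Form V)) : Form V) =
      (Complex.I / 2) ^ L.length • word e (L.flatMap fun j => [Sum.inl j, Sum.inr j]) := by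
    intro L
    induction L with
    | nil => simp
    | cons j L ih =>
      rw [List.map_cons, List.prod_cons, List.flatMap_cons, word_append, List.length_cons]
      change (vol e j : Form V) * _ = _
      rw [ih, coe_vol, smul_mul_smul_comm, pow_succ']
      simp
  rw [volProd, ← prod_map_toList, h, length_toList, pairs]

/-- The letters of `dz_A ∧ dz̄_B`. -/
def letters (A B : Finset ι) : List (ι ⊕ ι) := A.toList.map Sum.inl ++ B.toList.map Sum.inr

omit [Fintype ι] [DecidableEq ι] in
@[simp] theorem inl_mem_letters {A B : Finset ι} {j : ι} : Sum.inl j ∈ letters A B ↔ j ∈ A := by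
  simp [letters]

omit [Fintype ι] [DecidableEq ι] in
@[simp] theorem inr_mem_letters {A B : Finset ι} {j : ι} : Sum.inr j ∈ letters A B ↔ j ∈ B := by
  simp [letters]

omit [Fintype ι] [DecidableEq ι] in
theorem nodup_letters (A B : Finset ι) : (letters A B).Nodup := by
  rw [letters, List.nodup_append']
  refine ⟨A.nodup_toList.map Sum.inl_injective, B.nodup_toList.map Sum.inr_injective, ?_⟩
  simp [List.disjoint_left]

omit [Fintype ι] [DecidableEq ι] in
theorem length_letters (A B : Finset ι) : (letters A B).length = A.card + B.card := by
  simp [letters]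

/-- The monomial `dz_A ∧ dz̄_B ∧ ∏_{j ∈ M} (i/2) dz_j ∧ dz̄_j`. -/
def mono (A B M : Finset ι) : Form V := word e (letters A B) * volProd e M

omit [DecidableEq ι] in
theorem mono_eq (A B M : Finset ι) :
    mono e A B M = (Complex.I / 2) ^ M.card • word e (letters A B ++ pairs M) := by
  rw [mono, coe_volProd, mul_smul_comm, word_append]

omit [Fintype ι] [DecidableEq ι] in
theorem nodup_letters_append_pairs_iff {A B M : Finset ι} :
    (letters A B ++ pairs M).Nodup ↔ Disjoint A M ∧ Disjoint B M := by
  rw [List.nodup_append']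
  simp only [nodup_letters, nodup_pairs, true_and, List.disjoint_left, Sum.forall, inl_mem_letters,
    inr_mem_letters, inl_mem_pairs, inr_mem_pairs, Finset.disjoint_left]

omit [DecidableEq ι] in
theorem mono_eq_zero {A B M : Finset ι} (h : ¬(Disjoint A M ∧ Disjoint B M)) :
    mono e A B M = 0 := by
  rw [mono_eq, word_eq_zero e (mt nodup_letters_append_pairs_iff.1 h), smul_zero]

/-- Index triples of the monomials that form an orthogonal basis. -/
def Reduced (A B M : Finset ι) : Prop := Disjoint A B ∧ Disjoint A M ∧ Disjoint B M

omit [DecidableEq ι] in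
theorem conjForm_mono (A B M : Finset ι) :
    conjForm V (mono e A B M) = (-1 : ℂ) ^ (A.card * B.card) • mono e B A M := by
  rw [mono, map_mul, conjForm_volProd, conjForm_word, mono, letters, letters, List.map_append,
    List.map_map, List.map_map, word_append, word_append, word_mul_word_comm]
  simp [Function.comp_def]

/-- A word without repeated letters is a multiple of a reduced monomial. -/
theorem word_eq_smul_mono {K : List (ι ⊕ ι)} (hK : K.Nodup) :
    ∃ (A B M : Finset ι) (c : ℂ), Reduced A B M ∧ word e K = c • mono e A B M ∧
      (∀ j, Sum.inl j ∈ K ↔ j ∈ A ∪ M) ∧ (∀ j, Sum.inr j ∈ K ↔ j ∈ B ∪ M) := by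
  classical
  -- Indices are sorted by whether dz_j alone, dz̄_j alone, or both occur in K.
  let A : Finset ι := univ.filter fun j => Sum.inl j ∈ K ∧ Sum.inr j ∉ K
  let B : Finset ι := univ.filter fun j => Sum.inl j ∉ K ∧ Sum.inr j ∈ K
  let M : Finset ι := univ.filter fun j => Sum.inl j ∈ K ∧ Sum.inr j ∈ K
  have hr : Reduced A B M := by
    refine ⟨?_, ?_, ?_⟩ <;> simp only [A, B, M, Finset.disjoint_left, mem_filter] <;>
      tauto
  have h1 : ∀ j, Sum.inl j ∈ K ↔ j ∈ A ∪ M := by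
    intro j; simp only [A, M, mem_union, mem_filter, mem_univ]; tauto
  have h2 : ∀ j, Sum.inr j ∈ K ↔ j ∈ B ∪ M := by
    intro j; simp only [B, M, mem_union, mem_filter, mem_univ]; tauto
  have hp : K.Perm (letters A B ++ pairs M) := by
    rw [List.perm_ext_iff_of_nodup hK (nodup_letters_append_pairs_iff.2 hr.2)]
    rintro (j | j)
    · simp [h1]
    · simp [h2]
  have hc : (Complex.I / 2) ^ M.card ≠ 0 := pow_ne_zero _ (by simp)
  have hw : word e (letters A B ++ pairs M) = ((Complex.I / 2) ^ M.card)⁻¹ • mono e A B M := by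
    rw [mono_eq, smul_smul, inv_mul_cancel₀ hc, one_smul]
  rcases word_perm e hp with h | h
  · exact ⟨A, B, M, _, hr, h.trans hw, h1, h2⟩
  · exact ⟨A, B, M, -((Complex.I / 2) ^ M.card)⁻¹, hr, by rw [h, hw, neg_smul], h1, h2⟩

theorem span_mono_eq_top :
    Submodule.span ℂ {x | ∃ A B M, Reduced A B M ∧ x = mono e A B M} = ⊤ := by
  rw [eq_top_iff, ← span_word e, Submodule.span_le]
  rintro _ ⟨K, rfl⟩
  by_cases hK : K.Nodup
  · obtain ⟨A, B, M, c, hr, h, -⟩ := word_eq_smul_mono e hK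
    rw [h]
    exact Submodule.smul_mem _ _ (Submodule.subset_span ⟨A, B, M, hr, rfl⟩)
  · rw [word_eq_zero e hK]; exact Submodule.zero_mem _

/-- Forms of type `(p,q)` are combinations of reduced monomials of type `(p,q)`. -/
theorem formsOfType_le_span_mono (p q : ℕ) :
    formsOfType V p q ≤ Submodule.span ℂ {x | ∃ A B M, Reduced A B M ∧ A.card + M.card = p ∧
      B.card + M.card = q ∧ x = mono e A B M} := by
  refine (formsOfType_le_span_word e p q).trans (Submodule.span_le.2 ?_)
  rintro _ ⟨P, Q, rfl, rfl, rfl⟩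
  by_cases hK : (P.map Sum.inl ++ Q.map Sum.inr : List (ι ⊕ ι)).Nodup
  · obtain ⟨A, B, M, c, hr, h, h1, h2⟩ := word_eq_smul_mono e hK
    rw [h]
    rw [List.nodup_append'] at hK
    have hP := List.Nodup.of_map _ hK.1
    have hQ := List.Nodup.of_map _ hK.2.1
    refine Submodule.smul_mem _ _ (Submodule.subset_span ⟨A, B, M, hr, ?_, ?_, rfl⟩)
    · rw [← card_union_of_disjoint hr.2.1, ← List.toFinset_card_of_nodup hP]
      congr 1
      ext j
      rw [← h1]; simp
    · rw [← card_union_of_disjoint hr.2.2, ← List.toFinset_card_of_nodup hQ]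
      congr 1
      ext j
      rw [← h2]; simp
  · rw [word_eq_zero e hK]; exact Submodule.zero_mem _

variable [FiniteDimensional ℂ V]

theorem inner_mono {A B M A' B' M' : Finset ι} (h : Reduced A B M) (h' : Reduced A' B' M') :
    inner ℂ (mono e A B M) (mono e A' B' M') =
      if A = A' ∧ B = B' ∧ M = M' then (2 : ℂ) ^ (A.card + B.card) else 0 := by
  split_ifs with he
  · obtain ⟨rfl, rfl, rfl⟩ := he
    rw [mono_eq, inner_smul_left, inner_smul_right,
      inner_word_self e (nodup_letters_append_pairs_iff.2 h.2), List.length_append, length_letters,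
      length_pairs, pow_add, pow_mul, map_pow, map_div₀, Complex.conj_I, map_ofNat]
    -- Each pair dz_j ∧ dz̄_j has squared norm 4, which |i/2|² normalizes to 1; so M does not
    -- contribute to the norm.
    have h4 : (-Complex.I / 2) * (Complex.I / 2) * (2 : ℂ) ^ 2 = 1 := by
      linear_combination (-1 : ℂ) * Complex.I_sq
    calc _ = (2 : ℂ) ^ (A.card + B.card) *
          ((-Complex.I / 2) * (Complex.I / 2) * (2 : ℂ) ^ 2) ^ M.card := by
          rw [mul_pow, mul_pow]; ring
      _ = _ := by rw [h4, one_pow, mul_one]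
  · rw [mono_eq, mono_eq, inner_smul_left, inner_smul_right]
    suffices hs : inner ℂ (word e (letters A B ++ pairs M)) (word e (letters A' B' ++ pairs M')) =
        (0 : ℂ) by rw [hs, mul_zero, mul_zero]
    by_cases hl : ∃ i, i ∈ letters A B ++ pairs M ∧ i ∉ letters A' B' ++ pairs M'
    · obtain ⟨i, h1, h2⟩ := hl
      exact inner_word_eq_zero e h1 h2
    · by_cases hl' : ∃ i, i ∈ letters A' B' ++ pairs M' ∧ i ∉ letters A B ++ pairs M
      · obtain ⟨i, h1, h2⟩ := hl'
        rw [← inner_conj_symm, inner_word_eq_zero e h1 h2, map_zero]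
      -- The two words have the same letters, and a reduced triple is determined by its letters.
      · exfalso
        push Not at hl hl'
        simp only [Sum.forall, List.mem_append, inl_mem_letters, inr_mem_letters, inl_mem_pairs,
          inr_mem_pairs] at hl hl'
        simp only [Reduced, Finset.disjoint_left] at h h'
        refine he ⟨?_, ?_, ?_⟩ <;> ext j <;> grind

end Monomials

/-! ### The operators on monomials -/

section Operators

open Finset

theorem dpow_zero {A : Type*} [Ring A] [Algebra ℂ A] (x : A) : dpow x 0 = 1 := by
  simp [dpow]

theorem dpow_succ {A : Type*} [Ring A] [Algebra ℂ A] (x : A) (k : ℕ) :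
    dpow x (k + 1) = ((k + 1 : ℂ)⁻¹) • (x * dpow x k) := by
  rw [dpow, dpow, mul_smul_comm, smul_smul, pow_succ', Nat.factorial_succ, Nat.cast_mul, mul_inv]
  push_cast
  rfl

variable {V : Type*} [NormedAddCommGroup V] [InnerProductSpace ℂ V] [FiniteDimensional ℂ V]
  {ι : Type*} [Fintype ι] (e : OrthonormalBasis ι ℂ V)

theorem fundamentalForm_eq_sum_vol : fundamentalForm V = ∑ j, (vol e j : Form V) := by
  rw [fundamentalForm_eq V e, smul_sum]
  rfl

variable [DecidableEq ι]

theorem fundamentalForm_mul_volProd (M : Finset ι) :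
    fundamentalForm V * volProd e M = ∑ j ∈ univ \ M, (volProd e (insert j M) : Form V) := by
  rw [fundamentalForm_eq_sum_vol e, sum_mul, ← sum_sdiff (subset_univ M)]
  have h1 : ∀ j, (vol e j : Form V) * volProd e M = ((vol e j * volProd e M :
    Subalgebra.center ℂ (Form V)) : Form V) := fun _ => rfl
  rw [sum_eq_zero (s := M), add_zero]
  · refine sum_congr rfl fun j hj => ?_
    rw [h1, vol_mul_volProd e (mem_sdiff.1 hj).2]
  · intro j hj
    rw [h1, vol_mul_volProd_of_mem e hj]; rfl

/-- As the vol_j commute and square to zero, ω^k is k! times the k-th elementary symmetric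
expression in them. -/
theorem dpow_fundamentalForm (k : ℕ) :
    dpow (fundamentalForm V) k = ∑ S ∈ powersetCard k univ, (volProd e S : Form V) := by
  induction k with
  | zero => simp [dpow_zero, volProd]
  | succ k ih =>
    rw [dpow_succ, ih, mul_sum]
    simp only [fundamentalForm_mul_volProd]
    rw [sum_powersetCard_sum_insert univ k fun S => (volProd e S : Form V), ← Nat.cast_smul_eq_nsmul ℂ,
      smul_smul, Nat.cast_succ, inv_mul_cancel₀ (Nat.cast_add_one_ne_zero k), one_smul]

theorem fundamentalForm_mul_mono (A B M : Finset ι) :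
    fundamentalForm V * mono e A B M = ∑ j ∈ univ \ M, mono e A B (insert j M) := by
  have h : Commute (word e (letters A B)) (fundamentalForm V) := by
    rw [fundamentalForm_eq_sum_vol e]
    exact Commute.sum_right _ _ _ fun j _ => Subalgebra.mem_center_iff.1 (vol e j).2 _
  rw [mono, ← mul_assoc, ← h.eq, mul_assoc, fundamentalForm_mul_volProd, mul_sum]
  rfl

/-- Applying ω may insert into M an index of A or B. Such a monomial is zero, and the orthogonality
formula remains valid for it. -/
theorem inner_mono_of_disjoint {A B M A' B' M' : Finset ι} (h : Disjoint A B)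
    (h' : Reduced A' B' M') : inner ℂ (mono e A B M) (mono e A' B' M') =
      if A = A' ∧ B = B' ∧ M = M' then (2 : ℂ) ^ (A'.card + B'.card) else 0 := by
  by_cases hr : Disjoint A M ∧ Disjoint B M
  · rw [inner_mono e ⟨h, hr⟩ h']
    split_ifs with he
    · rw [he.1, he.2.1]
    · rfl
  · rw [mono_eq_zero e hr, inner_zero_left, if_neg]
    rintro ⟨rfl, rfl, rfl⟩
    exact hr h'.2

/-- Pair with monomials: inserting j into M' gives M exactly when M' is M with j removed. The
coefficients are 1 because the norms do not depend on M. -/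
theorem lefschetzAdjoint_mono {A B M : Finset ι} (h : Reduced A B M) :
    lefschetzAdjoint V (mono e A B M) = ∑ j ∈ M, mono e A B (M.erase j) := by
  refine ext_inner_left ℂ fun y => ?_
  rw [lefschetzAdjoint, LinearMap.adjoint_inner_right]
  change inner ℂ (fundamentalForm V * y) _ = _
  have hy : y ∈ Submodule.span ℂ {x | ∃ A B M, Reduced A B M ∧ x = mono e A B M} := by
    rw [span_mono_eq_top]; trivial
  induction hy using Submodule.span_induction with
  | zero => rw [mul_zero, inner_zero_left, inner_zero_left]
  | add x y _ _ hx hy => rw [mul_add, inner_add_left, inner_add_left, hx, hy]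
  | smul c x _ hx => rw [mul_smul_comm, inner_smul_left, inner_smul_left, hx]
  | mem x hx =>
    obtain ⟨A', B', M', h', rfl⟩ := hx
    rw [fundamentalForm_mul_mono, sum_inner, inner_sum]
    have h1 : ∀ j ∈ M, inner ℂ (mono e A' B' M') (mono e A B (M.erase j)) =
        if A' = A ∧ B' = B ∧ M' = M.erase j then (2 : ℂ) ^ (A.card + B.card) else 0 := fun j _ =>
      inner_mono_of_disjoint e h'.1 ⟨h.1, h.2.1.mono_right (erase_subset _ _),
        h.2.2.mono_right (erase_subset _ _)⟩
    rw [sum_congr rfl h1, sum_congr rfl fun j _ => inner_mono_of_disjoint e h'.1 h]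
    by_cases hAB : A' = A ∧ B' = B
    · simp only [hAB, true_and]
      rw [← sum_filter, ← sum_filter]
      refine sum_congr ?_ fun _ _ => rfl
      ext j
      simp only [mem_filter, mem_sdiff, mem_univ, true_and]
      constructor
      · rintro ⟨hj, rfl⟩
        exact ⟨mem_insert_self _ _, (erase_insert hj).symm⟩
      · rintro ⟨hj, rfl⟩
        exact ⟨notMem_erase _ _, insert_erase hj⟩
    · rw [sum_eq_zero, sum_eq_zero]
      · exact fun j _ => if_neg fun hc => hAB ⟨hc.1, hc.2.1⟩
      · exact fun j _ => if_neg fun hc => hAB ⟨hc.1, hc.2.1⟩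

theorem dpow_lefschetzAdjoint_mono {A B M : Finset ι} (h : Reduced A B M) (l : ℕ) :
    dpow (lefschetzAdjoint V) l (mono e A B M) = ∑ S ∈ powersetCard l M, mono e A B (M \ S) := by
  induction l with
  | zero => simp [dpow_zero]
  | succ l ih =>
    rw [dpow_succ, LinearMap.smul_apply, Module.End.mul_apply, ih, map_sum]
    have h1 : ∀ S ∈ powersetCard l M, lefschetzAdjoint V (mono e A B (M \ S)) =
        ∑ j ∈ M \ S, mono e A B (M \ insert j S) := fun S _ => by
      rw [lefschetzAdjoint_mono e ⟨h.1, h.2.1.mono_right sdiff_subset,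
        h.2.2.mono_right sdiff_subset⟩]
      simp only [sdiff_insert]
    rw [sum_congr rfl h1, sum_powersetCard_sum_insert M l fun S => mono e A B (M \ S),
      ← Nat.cast_smul_eq_nsmul ℂ, smul_smul, Nat.cast_succ,
      inv_mul_cancel₀ (Nat.cast_add_one_ne_zero l), one_smul]

end Operators

/-! ### The Weil operator -/

section Weil

open Finset

variable {V : Type*} [NormedAddCommGroup V] [InnerProductSpace ℂ V] [FiniteDimensional ℂ V]

theorem inner_eq_zero_of_type_ne {p q p' q' : ℕ} (hne : ¬(p = p' ∧ q = q')) {u v : Form V}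
    (hu : u ∈ formsOfType V p q) (hv : v ∈ formsOfType V p' q') : inner ℂ u v = (0 : ℂ) := by
  replace hu := formsOfType_le_span_mono (stdOrthonormalBasis ℂ V) _ _ hu
  replace hv := formsOfType_le_span_mono (stdOrthonormalBasis ℂ V) _ _ hv
  induction hu using Submodule.span_induction with
  | zero => exact inner_zero_left _
  | add x y _ _ hx hy => rw [inner_add_left, hx, hy, add_zero]
  | smul c x _ hx => rw [inner_smul_left, hx, mul_zero]
  | mem x hx =>
    obtain ⟨A, B, M, h, hp, hq, rfl⟩ := hx
    induction hv using Submodule.span_induction with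
    | zero => exact inner_zero_right _
    | add x y _ _ hx hy => rw [inner_add_right, hx, hy, add_zero]
    | smul c x _ hx => rw [inner_smul_right, hx, mul_zero]
    | mem x hx =>
      obtain ⟨A', B', M', h', hp', hq', rfl⟩ := hx
      rw [inner_mono _ h h', if_neg]
      rintro ⟨rfl, rfl, rfl⟩
      exact hne ⟨hp.symm.trans hp', hq.symm.trans hq'⟩

/-- Justifies the truncation of the sum in `weilOp` at p, q ≤ n: the disjoint unions A ∪ M and B ∪ M
have at most n elements. -/
theorem eq_zero_of_finrank_lt {p q : ℕ} {u : Form V} (hu : u ∈ formsOfType V p q)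
    (h : Module.finrank ℂ V < p ∨ Module.finrank ℂ V < q) : u = 0 := by
  replace hu := formsOfType_le_span_mono (stdOrthonormalBasis ℂ V) _ _ hu
  rw [← Submodule.mem_bot ℂ]
  refine Submodule.span_le.2 ?_ hu
  rintro _ ⟨A, B, M, hr, rfl, rfl, -⟩
  exfalso
  rw [← card_union_of_disjoint hr.2.1, ← card_union_of_disjoint hr.2.2] at h
  have h1 := card_le_univ (A ∪ M)
  have h2 := card_le_univ (B ∪ M)
  rw [Fintype.card_fin] at h1 h2
  omega

theorem typeProj_apply {p q : ℕ} {v : Form V} (hv : v ∈ formsOfType V p q) (p' q' : ℕ) :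
    typeProj V p' q' v = if p' = p ∧ q' = q then v else 0 := by
  change (formsOfType V p' q').starProjection v = _
  split_ifs with h
  · obtain ⟨rfl, rfl⟩ := h
    exact Submodule.starProjection_eq_self_iff.2 hv
  · rw [Submodule.starProjection_apply_eq_zero_iff, Submodule.mem_orthogonal]
    exact fun u hu => inner_eq_zero_of_type_ne h hu hv

theorem weilOp_apply {p q : ℕ} {v : Form V} (hv : v ∈ formsOfType V p q) :
    weilOp V v = (Complex.I ^ ((p : ℤ) - (q : ℤ))) • v := by
  by_cases h : Module.finrank ℂ V < p ∨ Module.finrank ℂ V < q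
  · rw [eq_zero_of_finrank_lt hv h, map_zero, smul_zero]
  · push Not at h
    simp only [weilOp, LinearMap.sum_apply, LinearMap.smul_apply, typeProj_apply hv]
    rw [sum_eq_single p, sum_eq_single q]
    · simp
    · intro q' _ hq; simp [hq]
    · intro hq; simp at hq; omega
    · intro p' _ hp; simp [hp]
    · intro hp; simp at hp; omega

end Weil

/-! ### Products of monomials in top degree -/

section TopDegree

open Finset

variable {V : Type*} [NormedAddCommGroup V] [InnerProductSpace ℂ V]
  {ι : Type*} [Fintype ι] (e : OrthonormalBasis ι ℂ V)

/-- Pairing each dz_j with its dz̄_j costs 0 + 1 + … + (k-1) = C(k, 2) transpositions, and each pair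
is -2i vol_j. -/
theorem word_inl_mul_word_inr (L : List ι) :
    word e (L.map Sum.inl) * word e (L.map Sum.inr) =
      ((-1 : ℂ) ^ L.length.choose 2 * (-2 * Complex.I) ^ L.length) •
        (((L.map (vol e)).prod : Subalgebra.center ℂ (Form V)) : Form V) := by
  induction L with
  | nil => simp
  | cons j L ih =>
    have hv : gen e (Sum.inl j) * gen e (Sum.inr j) = (-2 * Complex.I) • (vol e j : Form V) := by
      rw [coe_vol, smul_smul]
      have : -2 * Complex.I * (Complex.I / 2) = 1 := by linear_combination -Complex.I_sq
      rw [this, one_smul]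
    have hs : word e (L.map Sum.inl) * gen e (Sum.inr j) =
        (-1 : ℂ) ^ L.length • (gen e (Sum.inr j) * word e (L.map Sum.inl)) := by
      rw [gen_mul_word, List.length_map, smul_smul, ← mul_pow]; simp
    rw [List.map_cons, List.map_cons, word_cons, word_cons, mul_assoc, ← mul_assoc (word e _), hs,
      smul_mul_assoc, mul_assoc, ih, mul_smul_comm, mul_smul_comm, mul_smul_comm, ← mul_assoc, hv,
      List.map_cons, List.prod_cons, smul_mul_assoc, smul_smul, smul_smul]
    change _ = _ • ((vol e j : Form V) * _)
    congr 1
    rw [List.length_cons, Nat.choose_succ_succ', Nat.choose_one_right, pow_add, pow_succ]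
    ring

theorem mono_mul_mono (A B M A' B' M' : Finset ι) :
    mono e A B M * mono e A' B' M' = word e (letters A B ++ letters A' B') *
      ((volProd e M * volProd e M' : Subalgebra.center ℂ (Form V)) : Form V) := by
  rw [mono, mono, word_append, mul_assoc, ← mul_assoc (volProd e M : Form V),
    (commute_volProd e M _).eq, mul_assoc, ← mul_assoc]
  rfl

/-- In dz_A dz̄_B dz_B dz̄_A the two middle factors are exchanged, with sign (-1)^(|B|²). Then dz_B
dz̄_B is central and can be moved out, leaving dz_A dz̄_A. -/
theorem word_letters_swap (A B : Finset ι) :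
    word e (letters A B ++ letters B A) =
      ((-1 : ℂ) ^ (B.card * B.card + A.card.choose 2 + B.card.choose 2) *
        (-2 * Complex.I) ^ (A.card + B.card)) •
        ((volProd e A * volProd e B : Subalgebra.center ℂ (Form V)) : Form V) := by
  have h : ∀ A : Finset ι, (A.toList.map (vol e)).prod = volProd e A := fun A =>
    prod_map_toList A (vol e)
  rw [letters, letters, word_append, word_append, word_append, mul_assoc, ← mul_assoc (word e _)
    (word e _) (word e _), word_mul_word_comm, word_inl_mul_word_inr, smul_smul, h, smul_mul_assoc,
    mul_smul_comm, (commute_volProd e B _).eq,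
    ← mul_assoc (word e (A.toList.map Sum.inl)), word_inl_mul_word_inr, h, smul_mul_assoc,
    smul_smul]
  change _ = _ • ((volProd e A : Form V) * (volProd e B : Form V))
  congr 1
  simp only [List.length_map, length_toList]
  ring

variable [DecidableEq ι]

/-- In top degree, a product of monomials vanishes unless their letters match. -/
theorem mono_mul_mono_mul_volProd_eq_zero {A B A' B' : Finset ι} (h : Disjoint A B)
    (h' : Disjoint A' B') (hne : ¬(A' = A ∧ B' = B)) {M M' R : Finset ι}
    (hc : A.card + B.card + A'.card + B'.card + 2 * (M.card + M'.card + R.card) =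
      2 * Fintype.card ι) :
    mono e A B M * mono e B' A' M' * (volProd e R : Form V) = 0 := by
  have h1 : mono e A B M * mono e B' A' M' * (volProd e R : Form V) =
      ((Complex.I / 2) ^ M.card * (Complex.I / 2) ^ M'.card * (Complex.I / 2) ^ R.card) •
        word e (letters A B ++ letters B' A' ++ pairs M ++ pairs M' ++ pairs R) := by
    rw [mono_mul_mono]
    change _ * ((volProd e M : Form V) * (volProd e M' : Form V)) * _ = _
    rw [coe_volProd, coe_volProd, coe_volProd]
    simp only [word_append, mul_smul_comm, smul_mul_assoc, smul_smul, mul_assoc]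
    congr 1
    ring
  rw [h1, word_eq_zero, smul_zero]
  intro hn
  -- A word of 2n letters without repetition uses each of the 2n available letters.
  have hall : ∀ i, i ∈ letters A B ++ letters B' A' ++ pairs M ++ pairs M' ++ pairs R := by
    have hu := eq_univ_of_card (letters A B ++ letters B' A' ++ pairs M ++ pairs M' ++
      pairs R).toFinset (by
        rw [List.toFinset_card_of_nodup hn]
        simp only [List.length_append, length_letters, length_pairs, Fintype.card_sum]
        omega)
    intro i
    rw [← List.mem_toFinset, hu]
    exact mem_univ i
  simp only [List.nodup_append', List.disjoint_left, List.mem_append] at hn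
  obtain ⟨⟨⟨⟨-, -, h2⟩, -, h3⟩, -, h4⟩, -, h5⟩ := hn
  have hl := fun j => hall (Sum.inl j)
  have hr := fun j => hall (Sum.inr j)
  simp only [List.mem_append, inl_mem_letters, inr_mem_letters, inl_mem_pairs, inr_mem_pairs,
    Sum.forall] at hl hr h2 h3 h4 h5
  rw [Finset.disjoint_left] at h h'
  -- If j lies in M, M' or R, both its letters are used there and j is in none of A, B, A', B'.
  -- Otherwise dz_j comes from exactly one of A, B' and dz̄_j from exactly one of B, A';
  -- disjointness of A, B and of A', B' then forces the match.
  have key : ∀ j, (j ∈ A' ↔ j ∈ A) ∧ (j ∈ B' ↔ j ∈ B) := by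
    intro j
    replace hl := hl j
    replace hr := hr j
    replace h := @h j
    replace h' := @h' j
    replace h2 := And.intro (@h2.1 j) (@h2.2 j)
    replace h3 := And.intro (@h3.1 j) (@h3.2 j)
    replace h4 := And.intro (@h4.1 j) (@h4.2 j)
    replace h5 := And.intro (@h5.1 j) (@h5.2 j)
    clear hall hc h1 hne
    grind
  exact hne ⟨ext fun j => (key j).1, ext fun j => (key j).2⟩

variable [FiniteDimensional ℂ V]

/-- Only the complement of E contributes: it is the only set of its size disjoint from E. Its size
is r, so r ≥ 0. -/
theorem volProd_mul_zdpow (E : Finset ι) {r : ℤ} (hr : (E.card : ℤ) + r = Fintype.card ι) :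
    (volProd e E : Form V) * zdpow (fundamentalForm V) r = volProd e univ := by
  have hE := card_le_univ E
  rw [zdpow, if_pos (by omega), dpow_fundamentalForm e, mul_sum]
  have h1 : ∀ R : Finset ι, (volProd e E : Form V) * volProd e R =
      ((if Disjoint E R then volProd e (E ∪ R) else 0 : Subalgebra.center ℂ (Form V)) : Form V) :=
    fun R => congrArg Subtype.val (volProd_mul_volProd e E R)
  simp only [h1]
  rw [sum_eq_single Eᶜ]
  · rw [if_pos disjoint_compl_right, union_compl]
  · intro R hR hne
    rw [if_neg]
    · rfl
    · intro hd
      refine hne (eq_of_subset_of_card_le (fun j hj => ?_) ?_)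
      · exact mem_compl.2 fun hE => Finset.disjoint_left.1 hd hE hj
      · rw [card_compl, (mem_powersetCard.1 hR).2]; omega
  · intro hc
    refine absurd (mem_powersetCard.2 ⟨subset_univ _, ?_⟩) hc
    rw [card_compl]; omega

theorem mono_mul_mono_mul_zdpow_eq_zero {A B A' B' : Finset ι} (h : Disjoint A B)
    (h' : Disjoint A' B') (hne : ¬(A' = A ∧ B' = B)) {M M' : Finset ι} {r : ℤ}
    (hc : (A.card + B.card + A'.card + B'.card + 2 * (M.card + M'.card) : ℤ) + 2 * r =
      2 * Fintype.card ι) :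
    mono e A B M * mono e B' A' M' * zdpow (fundamentalForm V) r = 0 := by
  rw [zdpow]
  split_ifs with hr
  · rw [dpow_fundamentalForm e, mul_sum]
    refine sum_eq_zero fun R hR => mono_mul_mono_mul_volProd_eq_zero e h h' hne ?_
    rw [(mem_powersetCard.1 hR).2]
    omega
  · rw [mul_zero]

/-- The exponent r may be negative, but only if M and M' meet, and then the product of the monomials
is already zero. -/
theorem mono_mul_mono_swap_mul_zdpow {A B M M' : Finset ι} (h : Reduced A B M)
    (h' : Reduced A B M') {r : ℤ}
    (hc : (A.card + B.card + M.card + M'.card : ℤ) + r = Fintype.card ι) :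
    mono e A B M * mono e B A M' * zdpow (fundamentalForm V) r =
      ((-1 : ℂ) ^ (B.card * B.card + A.card.choose 2 + B.card.choose 2) *
        (-2 * Complex.I) ^ (A.card + B.card) * if Disjoint M M' then 1 else 0) •
          (volProd e univ : Form V) := by
  rw [mono_mul_mono, word_letters_swap, smul_mul_assoc, smul_mul_assoc,
    mul_smul _ (if Disjoint M M' then (1 : ℂ) else 0)]
  congr 1
  have h1 : ((volProd e A * volProd e B : Subalgebra.center ℂ (Form V)) : Form V) *
      ((volProd e M * volProd e M' : Subalgebra.center ℂ (Form V)) : Form V) =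
      ((volProd e A * volProd e B * (volProd e M * volProd e M') :
        Subalgebra.center ℂ (Form V)) : Form V) := rfl
  rw [h1, volProd_mul_volProd, if_pos h.1, volProd_mul_volProd e M]
  split_ifs with hd
  · have hd' : Disjoint (A ∪ B) (M ∪ M') := by
      rw [disjoint_union_left, disjoint_union_right, disjoint_union_right]
      exact ⟨⟨h.2.1, h'.2.1⟩, h.2.2, h'.2.2⟩
    rw [volProd_mul_volProd, if_pos hd', volProd_mul_zdpow e, one_smul]
    rw [card_union_of_disjoint hd', card_union_of_disjoint h.1, card_union_of_disjoint hd]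
    push_cast
    linarith
  · rw [mul_zero, zero_smul]
    exact zero_mul _

end TopDegree

/-! ### The pairing formula -/

section Pairing

open Finset

/-- Here a, b, m are the sizes of A, B, M. On the left stand, in order, the conjugated Weil factor,
the sign of `conjForm_mono`, the constant of `word_letters_swap` and the value of
`sum_b_card_disjoint`. -/
theorem conj_I_zpow_mul (a b m : ℕ) :
    conj (Complex.I ^ (((a + m : ℕ) : ℤ) - ((b + m : ℕ) : ℤ))) * (-1 : ℂ) ^ (a * b) *
      ((-1 : ℂ) ^ (b * b + a.choose 2 + b.choose 2) * (-2 * Complex.I) ^ (a + b)) * (-1) ^ m =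
    (-1 : ℂ) ^ ((a + m + (b + m)) * (a + m + (b + m) + 1) / 2) * 2 ^ (a + b) := by
  have hI : (-Complex.I) ≠ 0 := neg_ne_zero.2 Complex.I_ne_zero
  have h1 : conj (Complex.I ^ (((a + m : ℕ) : ℤ) - ((b + m : ℕ) : ℤ))) *
      (-Complex.I) ^ (a + b) = (-1) ^ a := by
    rw [map_zpow₀, Complex.conj_I, ← zpow_natCast (-Complex.I) (a + b), ← zpow_add₀ hI]
    have : ((a + m : ℕ) : ℤ) - ((b + m : ℕ) : ℤ) + ((a + b : ℕ) : ℤ) = ((2 * a : ℕ) : ℤ) := by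
      push_cast; ring
    rw [this, zpow_natCast, pow_mul, neg_sq, Complex.I_sq]
  have h2 : (-2 * Complex.I) ^ (a + b) = 2 ^ (a + b) * (-Complex.I) ^ (a + b) := by
    rw [← mul_pow]; congr 1; ring
  have h3 : (-1 : ℂ) ^ ((a + m + (b + m)) * (a + m + (b + m) + 1) / 2) =
      (-1) ^ (a + a * b + (b * b + a.choose 2 + b.choose 2) + m) := by
    have hp : ∀ n, n.choose 2 * 2 = n * (n - 1) := fun n => by
      rw [Nat.choose_two_right, Nat.div_mul_cancel (Nat.even_mul_pred_self n).two_dvd]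
    have hb : (-1 : ℂ) ^ (b * b) = (-1) ^ b := by
      rcases Nat.even_or_odd b with h | h
      · rw [(h.mul_left b).neg_one_pow, h.neg_one_pow]
      · rw [(h.mul h).neg_one_pow, h.neg_one_pow]
    -- For k = a + b + 2m this expands k(k+1)/2, with the even part split off.
    have h4 : (a + m + (b + m)) * (a + m + (b + m) + 1) / 2 =
        a + a * b + b + a.choose 2 + b.choose 2 + m + 2 * (m * (a + b) + m * m) := by
      refine Nat.div_eq_of_eq_mul_left two_pos ?_
      have ha' := hp a
      have hb' := hp b
      have hq : ∀ n : ℕ, n * (n - 1) + n = n * n := fun n => by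
        rcases n with _ | n
        · rfl
        · simp; ring
      have hqa := hq a
      have hqb := hq b
      rw [← ha'] at hqa
      rw [← hb'] at hqb
      nlinarith
    rw [h4, pow_add _ _ (2 * _), pow_mul, neg_one_sq, one_pow, mul_one]
    simp only [pow_add, hb]
    ring
  rw [h2, h3]
  simp only [pow_add] at h1 ⊢
  linear_combination ((-1 : ℂ) ^ (a * b) * ((-1) ^ (b * b) * (-1) ^ a.choose 2 *
    (-1) ^ b.choose 2) * (2 ^ a * 2 ^ b) * (-1) ^ m) * h1

variable {V : Type*} [NormedAddCommGroup V] [InnerProductSpace ℂ V] [FiniteDimensional ℂ V]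
  {ι : Type*} [Fintype ι] [DecidableEq ι] (e : OrthonormalBasis ι ℂ V)

theorem pairing_mono {A B M A' B' M' : Finset ι} (h : Reduced A B M) (h' : Reduced A' B' M')
    {p q : ℕ} (hp : A.card + M.card = p) (hq : B.card + M.card = q)
    (hp' : A'.card + M'.card = p) (hq' : B'.card + M'.card = q) :
    ((-1 : ℂ) ^ ((p + q) * (p + q + 1) / 2) * inner ℂ (mono e A' B' M') (mono e A B M)) •
        dpow (fundamentalForm V) (Fintype.card ι) =
      ∑ l ∈ range (Fintype.card ι + 1), ((-1 : ℂ) ^ l * (b l : ℂ)) •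
        (dpow (lefschetzAdjoint V) l (mono e A B M) * dpow (lefschetzAdjoint V) l
            (conjForm V ((Complex.I ^ ((p : ℤ) - (q : ℤ))) • mono e A' B' M')) *
          zdpow (fundamentalForm V)
            ((Fintype.card ι : ℤ) - (p : ℤ) - (q : ℤ) + 2 * (l : ℤ))) := by
  have hs : Reduced B' A' M' := ⟨h'.1.symm, h'.2.2, h'.2.1⟩
  have hred : ∀ {A B M : Finset ι} (S : Finset ι), Reduced A B M → Reduced A B (M \ S) :=
    fun S h => ⟨h.1, h.2.1.mono_right sdiff_subset, h.2.2.mono_right sdiff_subset⟩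
  set c : ℂ := conj (Complex.I ^ ((p : ℤ) - (q : ℤ))) * (-1 : ℂ) ^ (A'.card * B'.card) with hcdef
  have hterm : ∀ l, dpow (lefschetzAdjoint V) l (mono e A B M) * dpow (lefschetzAdjoint V) l
      (conjForm V ((Complex.I ^ ((p : ℤ) - (q : ℤ))) • mono e A' B' M')) *
        zdpow (fundamentalForm V) ((Fintype.card ι : ℤ) - (p : ℤ) - (q : ℤ) + 2 * (l : ℤ)) =
      c • ∑ S ∈ powersetCard l M, ∑ S' ∈ powersetCard l M',
        mono e A B (M \ S) * mono e B' A' (M' \ S') *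
          zdpow (fundamentalForm V) ((Fintype.card ι : ℤ) - (p : ℤ) - (q : ℤ) + 2 * (l : ℤ)) := by
    intro l
    rw [conjForm_smul, conjForm_mono, smul_smul, map_smul, dpow_lefschetzAdjoint_mono e h,
      dpow_lefschetzAdjoint_mono e hs, mul_smul_comm, smul_mul_assoc, sum_mul_sum, sum_mul]
    simp only [sum_mul, hcdef]
  have hcard : ∀ {l : ℕ} {M S : Finset ι}, S ∈ powersetCard l M →
      (((M \ S).card : ℕ) : ℤ) = M.card - l := by
    intro l M S hS
    obtain ⟨h1, h2⟩ := mem_powersetCard.1 hS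
    rw [card_sdiff_of_subset h1, h2, Nat.cast_sub (h2 ▸ card_le_card h1)]
  simp only [hterm]
  by_cases hne : A' = A ∧ B' = B
  · obtain ⟨rfl, rfl⟩ := hne
    have hMM : M.card = M'.card := by omega
    -- This constant does not depend on l, S or S', so only the number of disjoint pairs remains in
    -- the sum.
    set d : ℂ := (-1 : ℂ) ^ (B'.card * B'.card + A'.card.choose 2 + B'.card.choose 2) *
        (-2 * Complex.I) ^ (A'.card + B'.card) with hd
    have hsum : ∀ l, ∑ S ∈ powersetCard l M, ∑ S' ∈ powersetCard l M',
        mono e A' B' (M \ S) * mono e B' A' (M' \ S') *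
          zdpow (fundamentalForm V) ((Fintype.card ι : ℤ) - (p : ℤ) - (q : ℤ) + 2 * (l : ℤ)) =
        (d * ((∑ S ∈ powersetCard l M, ∑ S' ∈ powersetCard l M',
          if Disjoint (M \ S) (M' \ S') then (1 : ℤ) else 0 : ℤ) : ℂ)) •
            (volProd e univ : Form V) := by
      intro l
      push_cast
      rw [mul_sum, sum_smul]
      refine sum_congr rfl fun S hS => ?_
      rw [mul_sum, sum_smul]
      refine sum_congr rfl fun S' hS' => ?_
      rw [mono_mul_mono_swap_mul_zdpow e (hred S h) (hred S' h')]
      · rw [hcard hS, hcard hS']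
        omega
    simp only [hsum, smul_smul]
    rw [← sum_smul, dpow_fundamentalForm e, ← card_univ, powersetCard_self, sum_singleton,
      inner_mono e h' h]
    congr 1
    have hcomb := congrArg (Int.cast : ℤ → ℂ)
      (sum_b_card_disjoint hMM (N := Fintype.card ι) (card_le_univ M))
    rw [Int.cast_sum] at hcomb
    rw [card_univ, sum_congr rfl fun l _ => show _ = c * d * (((-1) ^ l * b l * ∑ S ∈ powersetCard l M,
      ∑ S' ∈ powersetCard l M', (if Disjoint (M \ S) (M' \ S') then (1 : ℤ) else 0) : ℤ) : ℂ) by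
        push_cast; ring, ← mul_sum, hcomb]
    by_cases hM : M = M'
    · subst hM
      have := conj_I_zpow_mul A'.card B'.card M.card
      rw [hp, hq] at this
      rw [if_pos ⟨rfl, rfl, rfl⟩, if_pos rfl, ← this, hcdef, hd]
      push_cast
      rfl
    · rw [if_neg fun hc => hM hc.2.2.symm, if_neg hM]
      simp
  · rw [inner_mono e h' h, if_neg fun hc => hne ⟨hc.1, hc.2.1⟩, mul_zero, zero_smul]
    refine (sum_eq_zero fun l _ => ?_).symm
    rw [sum_eq_zero, smul_zero, smul_zero]
    intro S hS
    refine sum_eq_zero fun S' hS' => mono_mul_mono_mul_zdpow_eq_zero e h.1 h'.1 hne ?_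
    rw [hcard hS, hcard hS']
    omega

end Pairing

end HermForm

end

theorem mainTheorem3 {V : Type*} [NormedAddCommGroup V] [InnerProductSpace ℂ V]
    [FiniteDimensional ℂ V] (n : ℕ) (hn : Module.finrank ℂ V = n) (p q : ℕ)
    (u v : HermForm.Form V) (hu : u ∈ HermForm.formsOfType V p q)
    (hv : v ∈ HermForm.formsOfType V p q) :
    ((-1 : ℂ) ^ ((p + q) * (p + q + 1) / 2) * inner ℂ v u) •
        HermForm.dpow (HermForm.fundamentalForm V) n =
      ∑ l ∈ Finset.range (n + 1), ((-1 : ℂ) ^ l * (HermForm.b l : ℂ)) •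
        (HermForm.dpow (HermForm.lefschetzAdjoint V) l u *
          HermForm.dpow (HermForm.lefschetzAdjoint V) l
            (HermForm.conjForm V (HermForm.weilOp V v)) *
          HermForm.zdpow (HermForm.fundamentalForm V)
            ((n : ℤ) - (p : ℤ) - (q : ℤ) + 2 * (l : ℤ))) := by
  subst hn
  -- On (p,q)-forms the Weil operator is a scalar; with it inserted, the right side is visibly
  -- conjugate-linear in `v`, and `v` can be decomposed into monomials.
  rw [HermForm.weilOp_apply hv]
  replace hu := HermForm.formsOfType_le_span_mono (stdOrthonormalBasis ℂ V) _ _ hu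
  replace hv := HermForm.formsOfType_le_span_mono (stdOrthonormalBasis ℂ V) _ _ hv
  induction hu using Submodule.span_induction with
  | zero => simp
  | add x y _ _ hx hy =>
    rw [inner_add_right, mul_add, add_smul, hx, hy, ← Finset.sum_add_distrib]
    refine Finset.sum_congr rfl fun l _ => ?_
    rw [map_add (HermForm.dpow (HermForm.lefschetzAdjoint V) l), add_mul, add_mul, smul_add]
  | smul c x _ hx =>
    rw [inner_smul_right, mul_left_comm, mul_smul, hx, Finset.smul_sum]
    refine Finset.sum_congr rfl fun l _ => ?_
    rw [LinearMap.map_smul, smul_mul_assoc, smul_mul_assoc, smul_comm]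
  | mem x hx =>
    obtain ⟨A, B, M, h, hp, hq, rfl⟩ := hx
    induction hv using Submodule.span_induction with
    | zero => simp
    | add x y _ _ hx hy =>
      rw [inner_add_left, mul_add, add_smul, hx, hy, ← Finset.sum_add_distrib]
      refine Finset.sum_congr rfl fun l _ => ?_
      rw [smul_add _ x y, map_add (HermForm.conjForm V), map_add (HermForm.dpow _ l), mul_add,
        add_mul, smul_add]
    | smul c x _ hx =>
      rw [inner_smul_left, mul_left_comm, mul_smul, hx, Finset.smul_sum]
      refine Finset.sum_congr rfl fun l _ => ?_
      rw [smul_comm _ c x, HermForm.conjForm_smul V c, LinearMap.map_smul, mul_smul_comm, smul_mul_assoc,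
        smul_comm]
    | mem x hx =>
      obtain ⟨A', B', M', h', hp', hq', rfl⟩ := hx
      have := HermForm.pairing_mono (stdOrthonormalBasis ℂ V) h h' hp hq hp' hq'
      rwa [Fintype.card_fin] at this
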